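/- Let $(\mathcal{M},\oplus,0)$ be a small symmetric monoidal category whose unit $0$ is an initial object, and let $\mathcal{A}$ be a Grothendieck category. We use the following notions. **The category $\widetilde{\mathcal{M}}$.** It has the same objects as $\mathcal{M}$, and $\widetilde{\mathcal{M}}(a,b)=\mathrm{colim}_{t\in\mathcal{M}}\,\mathcal{M}(a,b\oplus t)$. The composite of the classes of $f:a\to b\oplus t$ and $g:b\to c\oplus u$ is the class of $a\xrightarrow{f} b\oplus t\xrightarrow{g\oplus t} c\oplus u\oplus t$. The sum $\oplus$ of $\mathcal{M}$ makes $\widetilde{\mathcal{M}}$ a symmetric monoidal category: the sum of the classes of $f:a\to b\oplus t$ and $g:c\to d\oplus u$ is the class of $a\oplus c\to b\oplus t\oplus d\oplus u\simeq b\oplus d\oplus t\oplus u$. Its unit $0$ is a null object, and $\widetilde{\mathcal{M}}$ is the universal symmetric monoidal category with null unit under $\mathcal{M}$. Let $\eta:\mathcal{M}\to\widetilde{\mathcal{M}}$ be the canonical functor: it is the identity on objects and sends $f:a\to b$ to the class of $f:a\to b\simeq b\oplus 0$. **Stable category and polynomial objects.** Let $\mathcal{N}$ be a small symmetric monoidal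 category with initial unit (below, $\mathcal{N}$ is $\mathcal{M}$ or $\widetilde{\mathcal{M}}$), and let $\mathbf{Fct}(\mathcal{N},\mathcal{A})$ be the category of functors $\mathcal{N}\to\mathcal{A}$. For an object $x$ of $\mathcal{N}$, let $\tau_x$ be the endofunctor of $\mathbf{Fct}(\mathcal{N},\mathcal{A})$ given by precomposition with $x\oplus -$, let $i_x:\mathrm{Id}\to\tau_x$ be induced by $0\to x$, and let $\kappa_x=\ker i_x$ and $\delta_x=\mathrm{coker}\, i_x$. A functor $F$ is *stably zero* if $F=\sum_x\kappa_x(F)$, the sum being over all objects $x$ of $\mathcal{N}$. The stably zero functors form a Serre (thick) subcategory; let $\mathbf{St}(\mathcal{N},\mathcal{A})$ be the quotient, in the sense of Gabriel, of $\mathbf{Fct}(\mathcal{N},\mathcal{A})$ by it, with canonical functor $\pi:\mathbf{Fct}(\mathcal{N},\mathcal{A})\to\mathbf{St}(\mathcal{N},\mathcal{A})$. The functors $\delta_x$ induce exact endofunctors, again written $\delta_x$, of $\mathbf{St}(\mathcal{N},\mathcal{A})$. For $n\in\mathbb{Z}$, the full subcategory $\mathcal{P}ol_n(\mathcal{N},\mathcal{A})$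 of $\mathbf{St}(\mathcal{N},\mathcal{A})$ is defined as follows: for $n<0$ it consists of the zero objects; for $n\ge 0$ it consists of the objects $X$ such that $\delta_x(X)$ belongs to $\mathcal{P}ol_{n-1}(\mathcal{N},\mathcal{A})$ for every object $x$ of $\mathcal{N}$. It is a Serre subcategory, so that one can form the quotient abelian category $\mathcal{P}ol_n(\mathcal{N},\mathcal{A})/\mathcal{P}ol_{n-1}(\mathcal{N},\mathcal{A})$. **Theorem.** Let $\eta^*:\mathbf{Fct}(\widetilde{\mathcal{M}},\mathcal{A})\to\mathbf{Fct}(\mathcal{M},\mathcal{A})$ be precomposition with $\eta$, and let $\alpha:\mathbf{Fct}(\mathcal{M},\mathcal{A})\to\mathbf{Fct}(\widetilde{\mathcal{M}},\mathcal{A})$ be its left adjoint, the left Kan extension along $\eta$. For every $n\in\mathbb{N}$, the functors $\eta^*$ and $\alpha$ induce mutually quasi-inverse equivalences of categories between $\mathcal{P}ol_n(\widetilde{\mathcal{M}},\mathcal{A})/\mathcal{P}ol_{n-1}(\widetilde{\mathcal{M}},\mathcal{A})$ and $\mathcal{P}ol_n(\mathcal{M},\mathcal{A})/\mathcal{P}ol_{n-1}(\mathcal{M},\mathcal{A})$.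 Explicitly: if $\pi(F)$ is in $\mathcal{P}ol_n$, then so is $\pi(\eta^*F)$ (for $F$ in $\mathbf{Fct}(\widetilde{\mathcal{M}},\mathcal{A})$), respectively $\pi(\alpha F)$ (for $F$ in $\mathbf{Fct}(\mathcal{M},\mathcal{A})$); and there are mutually quasi-inverse equivalences between the two quotient categories which, composed with the canonical functors to these quotients from the categories of functors $F$ such that $\pi(F)$ is in $\mathcal{P}ol_n$, are naturally isomorphic to the functors obtained from $\eta^*$ and from $\alpha$ respectively. -/

import Mathlib

open CategoryTheory CategoryTheory.Limits CategoryTheory.MonoidalCategory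

universe w v u

/-- A monoidal category whose unit object is initial. -/
class UnitIsInitial (M : Type u) [Category.{v} M] [MonoidalCategory M] : Prop where
  nonempty_isInitial : Nonempty (IsInitial (𝟙_ M))

/-- The unique morphism from the unit to `x`. -/
noncomputable def fromUnit {M : Type u} [Category.{v} M] [MonoidalCategory M] [UnitIsInitial M]
    (x : M) : 𝟙_ M ⟶ x :=
  (UnitIsInitial.nonempty_isInitial (M := M)).some.to x

theorem fromUnit_unique {M : Type u} [Category.{v} M] [MonoidalCategory M] [UnitIsInitial M]
    {x : M} (f g : 𝟙_ M ⟶ x) : f = g :=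
  (UnitIsInitial.nonempty_isInitial (M := M)).some.hom_ext f g

/-- The category `M~`: it has the same objects as `M`. -/
structure Tilde (M : Type u) : Type u where
  /-- The object of `M~` given by an object of `M`. -/
  ob ::
  /-- The underlying object of `M`. -/
  of : M

namespace Tilde

section

variable {M : Type w} [SmallCategory M] [MonoidalCategory M]

/-- The set of morphisms `a ⟶ b` in `M~`: the colimit over `t` in `M` of the sets
`a ⟶ b ⊗ t`. -/
def Hom (a b : Tilde M) : Type w :=
  (tensorLeft b.of ⋙ coyoneda.obj (Opposite.op a.of)).ColimitType

/-- The morphism of `M~` represented by `f : a ⟶ b ⊗ t`. -/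
def homMk {a b : Tilde M} (t : M) (f : a.of ⟶ b.of ⊗ t) : Hom a b :=
  (tensorLeft b.of ⋙ coyoneda.obj (Opposite.op a.of)).ιColimitType t f

theorem homMk_eq {a b : Tilde M} {t t' : M} (s : t ⟶ t') (f : a.of ⟶ b.of ⊗ t)
    (f' : a.of ⟶ b.of ⊗ t') (h : f ≫ b.of ◁ s = f') : homMk t f = homMk t' f' := by
  subst h
  exact ((tensorLeft b.of ⋙ coyoneda.obj (Opposite.op a.of)).ιColimitType_map s f).symm

theorem homMk_surjective {a b : Tilde M} (ξ : Hom a b) :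
    ∃ (t : M) (f : a.of ⟶ b.of ⊗ t), homMk t f = ξ :=
  Functor.ιColimitType_jointly_surjective _ ξ

/-- Composition in `M~`: the composite of the classes of `f : a ⟶ b ⊗ t` and
`g : b ⟶ c ⊗ u` is the class of `a ⟶ b ⊗ t ⟶ (c ⊗ u) ⊗ t ≅ c ⊗ (u ⊗ t)`. -/
def comp {a b c : Tilde M} (ξ : Hom a b) (ζ : Hom b c) : Hom a c :=
  Quot.map₂ (fun p q => ⟨q.1 ⊗ p.1, p.2 ≫ q.2 ▷ p.1 ≫ (α_ c.of q.1 p.1).hom⟩)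
    (by
      rintro ⟨t, f⟩ ⟨u, g⟩ ⟨u', g'⟩ ⟨s, hs⟩
      change u ⟶ u' at s
      obtain rfl : g' = g ≫ c.of ◁ s := hs
      exact ⟨s ▷ t, by simp⟩)
    (by
      rintro ⟨t, f⟩ ⟨t', f'⟩ ⟨u, g⟩ ⟨s, hs⟩
      change t ⟶ t' at s
      obtain rfl : f' = f ≫ b.of ◁ s := hs
      exact ⟨u ◁ s, by simp [whisker_exchange_assoc]⟩) ξ ζ

instance : Category (Tilde M) where
  Hom := Hom
  id a := homMk (𝟙_ M) (ρ_ a.of).inv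
  comp := comp
  id_comp := by
    intro a b ξ
    obtain ⟨t, f, rfl⟩ := homMk_surjective ξ
    exact homMk_eq (ρ_ t).hom _ _ (by simp)
  comp_id := by
    intro a b ξ
    obtain ⟨t, f, rfl⟩ := homMk_surjective ξ
    exact homMk_eq (λ_ t).hom _ _ (by simp)
  assoc := by
    intro a b c d ξ ζ χ
    obtain ⟨t, f, rfl⟩ := homMk_surjective ξ
    obtain ⟨u, g, rfl⟩ := homMk_surjective ζ
    obtain ⟨s, h, rfl⟩ := homMk_surjective χ
    exact homMk_eq (α_ s u t).inv _ _ (by simp)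

/-- The class in `M~` of `f : a ⟶ b ⊗ t`, as a morphism of the category `M~`. -/
def mk {a b : Tilde M} (t : M) (f : a.of ⟶ b.of ⊗ t) : a ⟶ b := homMk t f

theorem mk_eq {a b : Tilde M} {t t' : M} (s : t ⟶ t') (f : a.of ⟶ b.of ⊗ t)
    (f' : a.of ⟶ b.of ⊗ t') (h : f ≫ b.of ◁ s = f') : mk t f = mk t' f' :=
  homMk_eq s f f' h

theorem mk_surjective {a b : Tilde M} (ξ : a ⟶ b) :
    ∃ (t : M) (f : a.of ⟶ b.of ⊗ t), mk t f = ξ :=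
  homMk_surjective ξ

theorem id_eq (a : Tilde M) : 𝟙 a = mk (𝟙_ M) (ρ_ a.of).inv := rfl

theorem mk_comp_mk {a b c : Tilde M} {t u : M} (f : a.of ⟶ b.of ⊗ t) (g : b.of ⟶ c.of ⊗ u) :
    mk t f ≫ mk u g = mk (u ⊗ t) (f ≫ g ▷ t ≫ (α_ c.of u t).hom) := rfl

/-- The morphism of `M~` given by a morphism of `M`: the image under the canonical map
`M(a, b) = M(a, b ⊗ 𝟙_) → colim M(a, b ⊗ t)`. -/
def ofHom {a b : Tilde M} (f : a.of ⟶ b.of) : a ⟶ b := mk (𝟙_ M) (f ≫ (ρ_ b.of).inv)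

theorem ofHom_id (a : Tilde M) : ofHom (𝟙 a.of) = 𝟙 a := by
  rw [ofHom, id_eq, Category.id_comp]

theorem ofHom_comp_mk {a b c : Tilde M} {t : M} (f : a.of ⟶ b.of) (g : b.of ⟶ c.of ⊗ t) :
    ofHom f ≫ mk t g = mk t (f ≫ g) := by
  rw [ofHom, mk_comp_mk]
  refine mk_eq (ρ_ t).hom _ _ ?_
  simp only [Category.assoc, whiskerLeft_rightUnitor, Iso.hom_inv_id_assoc,
    rightUnitor_naturality, Iso.inv_hom_id_assoc]

theorem mk_comp_ofHom {a b c : Tilde M} {t : M} (f : a.of ⟶ b.of ⊗ t) (g : b.of ⟶ c.of) :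
    mk t f ≫ ofHom g = mk t (f ≫ g ▷ t) := by
  rw [ofHom, mk_comp_mk]
  exact mk_eq (λ_ t).hom _ _ (by simp)

theorem ofHom_comp {a b c : Tilde M} (f : a.of ⟶ b.of) (g : b.of ⟶ c.of) :
    ofHom f ≫ ofHom g = ofHom (f ≫ g) := by
  rw [ofHom, mk_comp_ofHom, ofHom]
  simp

/-- The isomorphism of `M~` given by an isomorphism of `M`. -/
def ofIso {a b : Tilde M} (e : a.of ≅ b.of) : a ≅ b where
  hom := ofHom e.hom
  inv := ofHom e.inv
  hom_inv_id := by rw [ofHom_comp, e.hom_inv_id, ofHom_id]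
  inv_hom_id := by rw [ofHom_comp, e.inv_hom_id, ofHom_id]

variable (M) in
/-- The canonical functor `M ⥤ M~`, which is the identity on objects. -/
def eta : M ⥤ Tilde M where
  obj a := ⟨a⟩
  map f := ofHom f
  map_id a := ofHom_id _
  map_comp f g := (ofHom_comp _ _).symm

end

section

variable {M : Type w} [SmallCategory M] [MonoidalCategory M] [SymmetricCategory M]

theorem tensorμ_naturality_right {b t d u u' : M} (s : u ⟶ u') :
    ((b ⊗ t) ◁ (d ◁ s)) ≫ tensorμ b t d u' = tensorμ b t d u ≫ ((b ⊗ d) ◁ (t ◁ s)) := by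
  simpa only [id_tensorHom, tensorHom_id, id_whiskerRight] using tensorμ_natural (𝟙 b) (𝟙 t) (𝟙 d) s

theorem tensorμ_naturality_left {b t t' d u : M} (s : t ⟶ t') :
    ((b ◁ s) ▷ (d ⊗ u)) ≫ tensorμ b t' d u = tensorμ b t d u ≫ ((b ⊗ d) ◁ (s ▷ u)) := by
  simpa only [id_tensorHom, tensorHom_id, id_whiskerRight, whiskerLeft_id]
    using tensorμ_natural (𝟙 b) s (𝟙 d) (𝟙 u)

theorem aux_left {a b c d t t' u : M} (f : a ⟶ b ⊗ t) (g : c ⟶ d ⊗ u) (s : t ⟶ t') :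
    ((f ≫ b ◁ s) ⊗ₘ g) ≫ tensorμ b t' d u =
      ((f ⊗ₘ g) ≫ tensorμ b t d u) ≫ (b ⊗ d) ◁ (s ▷ u) := by
  have h : ((f ≫ b ◁ s) ⊗ₘ g) = (f ⊗ₘ g) ≫ (b ◁ s) ▷ (d ⊗ u) := by
    rw [← tensorHom_id, tensorHom_comp_tensorHom, Category.comp_id]
  rw [Category.assoc, ← tensorμ_naturality_left, h, Category.assoc]

theorem aux_right {a b c d t u u' : M} (f : a ⟶ b ⊗ t) (g : c ⟶ d ⊗ u) (s : u ⟶ u') :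
    (f ⊗ₘ (g ≫ d ◁ s)) ≫ tensorμ b t d u' =
      ((f ⊗ₘ g) ≫ tensorμ b t d u) ≫ (b ⊗ d) ◁ (t ◁ s) := by
  have h : (f ⊗ₘ (g ≫ d ◁ s)) = (f ⊗ₘ g) ≫ (b ⊗ t) ◁ (d ◁ s) := by
    rw [← id_tensorHom (b ⊗ t), tensorHom_comp_tensorHom, Category.comp_id]
  rw [Category.assoc, ← tensorμ_naturality_right, h, Category.assoc]

/-- The sum of the morphisms of `M~` represented by `f : a ⟶ b ⊗ t` and `g : c ⟶ d ⊗ u` is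
represented by `a ⊗ c ⟶ (b ⊗ t) ⊗ (d ⊗ u) ≅ (b ⊗ d) ⊗ (t ⊗ u)`. -/
def sumHom {a b c d : Tilde M} (ξ : a ⟶ b) (ζ : c ⟶ d) :
    Tilde.ob (a.of ⊗ c.of) ⟶ Tilde.ob (b.of ⊗ d.of) :=
  Quot.map₂ (fun p q => ⟨p.1 ⊗ q.1, (p.2 ⊗ₘ q.2) ≫ tensorμ b.of p.1 d.of q.1⟩)
    (by
      rintro ⟨t, f⟩ ⟨u, g⟩ ⟨u', g'⟩ ⟨s, hs⟩
      change u ⟶ u' at s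
      obtain rfl : g' = g ≫ d.of ◁ s := hs
      exact ⟨t ◁ s, aux_right f g s⟩)
    (by
      rintro ⟨t, f⟩ ⟨t', f'⟩ ⟨u, g⟩ ⟨s, hs⟩
      change t ⟶ t' at s
      obtain rfl : f' = f ≫ b.of ◁ s := hs
      exact ⟨s ▷ u, aux_left f g s⟩) ξ ζ

theorem sumHom_mk_mk {a b c d : Tilde M} {t u : M} (f : a.of ⟶ b.of ⊗ t) (g : c.of ⟶ d.of ⊗ u) :
    sumHom (mk t f) (mk u g) = mk (t ⊗ u) ((f ⊗ₘ g) ≫ tensorμ b.of t d.of u) := rfl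

theorem tensorμ_unit_unit (b d : M) :
    ((ρ_ b).inv ⊗ₘ (ρ_ d).inv) ≫ tensorμ b (𝟙_ M) d (𝟙_ M) ≫ (b ⊗ d) ◁ (λ_ (𝟙_ M)).hom =
      (ρ_ (b ⊗ d)).inv := by
  have h := rightUnitor_monoidal b d
  rw [← cancel_mono (ρ_ (b ⊗ d)).hom, Category.assoc, Category.assoc, ← h]
  simp

theorem sumHom_ofHom {a b c d : Tilde M} (f : a.of ⟶ b.of) (g : c.of ⟶ d.of) :
    sumHom (ofHom f) (ofHom g) = ofHom (f ⊗ₘ g) := by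
  refine mk_eq (λ_ (𝟙_ M)).hom _ _ ?_
  dsimp only
  rw [← tensorHom_comp_tensorHom, Category.assoc, Category.assoc, tensorμ_unit_unit]

theorem sumHom_id_ofHom (a : Tilde M) {b c : Tilde M} (f : b.of ⟶ c.of) :
    sumHom (𝟙 a) (ofHom f) = ofHom (a.of ◁ f) := by
  rw [← ofHom_id, sumHom_ofHom, id_tensorHom]

theorem sumHom_ofHom_id (a : Tilde M) {b c : Tilde M} (f : b.of ⟶ c.of) :
    sumHom (ofHom f) (𝟙 a) = ofHom (f ▷ a.of) := by
  rw [← ofHom_id, sumHom_ofHom, tensorHom_id]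

theorem aux_comp {a b c a' b' c' t t' u u' : M} (f : a ⟶ b ⊗ t) (f' : a' ⟶ b' ⊗ t')
    (g : b ⟶ c ⊗ u) (g' : b' ⟶ c' ⊗ u') :
    (((f ≫ g ▷ t ≫ (α_ c u t).hom) ⊗ₘ (f' ≫ g' ▷ t' ≫ (α_ c' u' t').hom)) ≫
      tensorμ c (u ⊗ t) c' (u' ⊗ t')) ≫ (c ⊗ c') ◁ tensorμ u t u' t' =
    ((f ⊗ₘ f') ≫ tensorμ b t b' t') ≫ ((g ⊗ₘ g') ≫ tensorμ c u c' u') ▷ (t ⊗ t') ≫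
      (α_ (c ⊗ c') (u ⊗ u') (t ⊗ t')).hom := by
  have h1 := tensorμ_natural g (𝟙 t) g' (𝟙 t')
  have h2 := associator_monoidal c u t c' u' t'
  rw [id_tensorHom_id] at h1
  simp only [tensorHom_id] at h1
  simp only [comp_whiskerRight, Category.assoc, ← tensorHom_comp_tensorHom, ← h2]
  rw [reassoc_of% h1]

theorem sumHom_comp {a b c a' b' c' : Tilde M} (f : a ⟶ b) (f' : a' ⟶ b') (g : b ⟶ c)
    (g' : b' ⟶ c') : sumHom f f' ≫ sumHom g g' = sumHom (f ≫ g) (f' ≫ g') := by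
  obtain ⟨t, f, rfl⟩ := mk_surjective f
  obtain ⟨t', f', rfl⟩ := mk_surjective f'
  obtain ⟨u, g, rfl⟩ := mk_surjective g
  obtain ⟨u', g', rfl⟩ := mk_surjective g'
  rw [sumHom_mk_mk, sumHom_mk_mk, mk_comp_mk, mk_comp_mk, mk_comp_mk, sumHom_mk_mk]
  exact (mk_eq (tensorμ u t u' t') _ _ (aux_comp f f' g g')).symm

theorem aux_associator {a b c a' b' c' t u s : M} (f : a ⟶ a' ⊗ t) (g : b ⟶ b' ⊗ u)
    (h : c ⟶ c' ⊗ s) :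
    (((((f ⊗ₘ g) ≫ tensorμ a' t b' u) ⊗ₘ h) ≫ tensorμ (a' ⊗ b') (t ⊗ u) c' s) ≫
      (α_ a' b' c').hom ▷ ((t ⊗ u) ⊗ s)) ≫ (a' ⊗ b' ⊗ c') ◁ (α_ t u s).hom =
    (α_ a b c).hom ≫ (f ⊗ₘ ((g ⊗ₘ h) ≫ tensorμ b' u c' s)) ≫ tensorμ a' t (b' ⊗ c') (u ⊗ s) := by
  have h1 := tensor_associativity a' t b' u c' s
  have h2 : ((f ⊗ₘ g) ≫ tensorμ a' t b' u ⊗ₘ h) =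
      ((f ⊗ₘ g) ⊗ₘ h) ≫ tensorμ a' t b' u ▷ (c' ⊗ s) := by
    rw [← tensorHom_id, tensorHom_comp_tensorHom, Category.comp_id]
  have h3 : (f ⊗ₘ ((g ⊗ₘ h) ≫ tensorμ b' u c' s)) =
      (f ⊗ₘ (g ⊗ₘ h)) ≫ (a' ⊗ t) ◁ tensorμ b' u c' s := by
    rw [← id_tensorHom, tensorHom_comp_tensorHom, Category.comp_id]
  rw [h2, h3]
  simp only [Category.assoc, ← MonoidalCategory.tensorHom_def]
  rw [h1, ← associator_naturality_assoc]

theorem sumHom_associator {a b c a' b' c' : Tilde M} (f : a ⟶ a') (g : b ⟶ b') (h : c ⟶ c') :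
    sumHom (sumHom f g) h ≫ ofHom (α_ a'.of b'.of c'.of).hom =
      ofHom (α_ a.of b.of c.of).hom ≫ sumHom f (sumHom g h) := by
  obtain ⟨t, f, rfl⟩ := mk_surjective f
  obtain ⟨u, g, rfl⟩ := mk_surjective g
  obtain ⟨s, h, rfl⟩ := mk_surjective h
  rw [sumHom_mk_mk, sumHom_mk_mk, sumHom_mk_mk, sumHom_mk_mk]
  exact (mk_comp_ofHom _ _).trans
    ((mk_eq (α_ t u s).hom _ _ (aux_associator f g h)).trans (ofHom_comp_mk _ _).symm)

theorem aux_leftUnitor {a b t : M} (f : a ⟶ b ⊗ t) :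
    ((((ρ_ (𝟙_ M)).inv ⊗ₘ f) ≫ tensorμ (𝟙_ M) (𝟙_ M) b t) ≫ (λ_ b).hom ▷ (𝟙_ M ⊗ t)) ≫
      b ◁ (λ_ t).hom = (λ_ a).hom ≫ f := by
  have h1 := tensor_left_unitality b t
  rw [← leftUnitor_naturality, h1, MonoidalCategory.tensorHom_def' (ρ_ (𝟙_ M)).inv f]
  simp only [MonoidalCategory.tensorHom_def, unitors_inv_equal, Category.assoc]

theorem sumHom_leftUnitor {a b : Tilde M} (f : a ⟶ b) :
    sumHom (𝟙 (⟨𝟙_ M⟩ : Tilde M)) f ≫ ofHom (λ_ b.of).hom = ofHom (λ_ a.of).hom ≫ f := by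
  obtain ⟨t, f, rfl⟩ := mk_surjective f
  rw [id_eq, sumHom_mk_mk]
  exact (mk_comp_ofHom _ _).trans
    ((mk_eq (λ_ t).hom _ _ (aux_leftUnitor f)).trans (ofHom_comp_mk _ _).symm)

theorem aux_rightUnitor {a b t : M} (f : a ⟶ b ⊗ t) :
    (((f ⊗ₘ (ρ_ (𝟙_ M)).inv) ≫ tensorμ b t (𝟙_ M) (𝟙_ M)) ≫ (ρ_ b).hom ▷ (t ⊗ 𝟙_ M)) ≫
      b ◁ (ρ_ t).hom = (ρ_ a).hom ≫ f := by
  have h1 := tensor_right_unitality b t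
  rw [← rightUnitor_naturality, h1, MonoidalCategory.tensorHom_def f (ρ_ (𝟙_ M)).inv]
  simp only [MonoidalCategory.tensorHom_def, unitors_inv_equal, Category.assoc]

theorem sumHom_rightUnitor {a b : Tilde M} (f : a ⟶ b) :
    sumHom f (𝟙 (⟨𝟙_ M⟩ : Tilde M)) ≫ ofHom (ρ_ b.of).hom = ofHom (ρ_ a.of).hom ≫ f := by
  obtain ⟨t, f, rfl⟩ := mk_surjective f
  rw [id_eq, sumHom_mk_mk]
  exact (mk_comp_ofHom _ _).trans
    ((mk_eq (ρ_ t).hom _ _ (aux_rightUnitor f)).trans (ofHom_comp_mk _ _).symm)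

theorem tensorμ_comp_braiding (b t d u : M) :
    tensorμ b t d u ≫ (β_ b d).hom ▷ (t ⊗ u) ≫ (d ⊗ b) ◁ (β_ t u).hom =
      (β_ (b ⊗ t) (d ⊗ u)).hom ≫ tensorμ d u b t := by
  simp [tensorμ, SymmetricCategory.braiding_swap_eq_inv_braiding b u]

theorem sumHom_braiding {a b c d : Tilde M} (f : a ⟶ b) (g : c ⟶ d) :
    sumHom f g ≫ ofHom (β_ b.of d.of).hom = ofHom (β_ a.of c.of).hom ≫ sumHom g f := by
  obtain ⟨t, f, rfl⟩ := mk_surjective f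
  obtain ⟨u, g, rfl⟩ := mk_surjective g
  rw [sumHom_mk_mk, sumHom_mk_mk]
  refine (mk_comp_ofHom _ _).trans (Eq.trans ?_ (ofHom_comp_mk _ _).symm)
  refine mk_eq (β_ t u).hom _ _ ?_
  dsimp only
  rw [Category.assoc, Category.assoc, tensorμ_comp_braiding,
    BraidedCategory.braiding_naturality_assoc]

instance : MonoidalCategoryStruct (Tilde M) where
  tensorObj a b := ⟨a.of ⊗ b.of⟩
  tensorUnit := ⟨𝟙_ M⟩
  tensorHom f g := sumHom f g
  whiskerLeft a _ _ f := sumHom (𝟙 a) f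
  whiskerRight f a := sumHom f (𝟙 a)
  associator a b c := ofIso (α_ a.of b.of c.of)
  leftUnitor a := ofIso (λ_ a.of)
  rightUnitor a := ofIso (ρ_ a.of)

instance : MonoidalCategory (Tilde M) :=
  MonoidalCategory.ofTensorHom
    (id_tensorHom_id := fun a b => by
      change sumHom (𝟙 a) (𝟙 b) = 𝟙 (Tilde.ob (a.of ⊗ b.of))
      rw [← ofHom_id, ← ofHom_id, ← ofHom_id, sumHom_ofHom, id_tensorHom_id])
    (id_tensorHom := fun _ _ _ _ => rfl)
    (tensorHom_id := fun _ _ => rfl)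
    (tensorHom_comp_tensorHom := sumHom_comp)
    (associator_naturality := sumHom_associator)
    (leftUnitor_naturality := sumHom_leftUnitor)
    (rightUnitor_naturality := sumHom_rightUnitor)
    (pentagon := fun a b c d => by
      change sumHom (ofHom (α_ a.of b.of c.of).hom) (𝟙 d) ≫ ofHom (α_ a.of (b.of ⊗ c.of) d.of).hom ≫
        sumHom (𝟙 a) (ofHom (α_ b.of c.of d.of).hom) =
        ofHom (α_ (a.of ⊗ b.of) c.of d.of).hom ≫ ofHom (α_ a.of b.of (c.of ⊗ d.of)).hom
      rw [sumHom_ofHom_id, sumHom_id_ofHom, ofHom_comp, ofHom_comp, ofHom_comp,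
        MonoidalCategory.pentagon])
    (triangle := fun a b => by
      change ofHom (α_ a.of (𝟙_ M) b.of).hom ≫ sumHom (𝟙 a) (ofHom (λ_ b.of).hom) =
        sumHom (ofHom (ρ_ a.of).hom) (𝟙 b)
      rw [sumHom_ofHom_id, sumHom_id_ofHom, ofHom_comp, MonoidalCategory.triangle])

instance : SymmetricCategory (Tilde M) where
  braiding a b := ofIso (β_ a.of b.of)
  braiding_naturality_right a _ _ f := sumHom_braiding (𝟙 a) f
  braiding_naturality_left f a := sumHom_braiding f (𝟙 a)
  hexagon_forward a b c := by
    change ofHom (α_ a.of b.of c.of).hom ≫ ofHom (β_ a.of (b.of ⊗ c.of)).hom ≫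
        ofHom (α_ b.of c.of a.of).hom =
      sumHom (ofHom (β_ a.of b.of).hom) (𝟙 c) ≫ ofHom (α_ b.of a.of c.of).hom ≫
        sumHom (𝟙 b) (ofHom (β_ a.of c.of).hom)
    rw [sumHom_ofHom_id, sumHom_id_ofHom, ofHom_comp, ofHom_comp, ofHom_comp, ofHom_comp,
      BraidedCategory.hexagon_forward]
  hexagon_reverse a b c := by
    change ofHom (α_ a.of b.of c.of).inv ≫ ofHom (β_ (a.of ⊗ b.of) c.of).hom ≫
        ofHom (α_ c.of a.of b.of).inv =
      sumHom (𝟙 a) (ofHom (β_ b.of c.of).hom) ≫ ofHom (α_ a.of c.of b.of).inv ≫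
        sumHom (ofHom (β_ a.of c.of).hom) (𝟙 b)
    rw [sumHom_ofHom_id, sumHom_id_ofHom, ofHom_comp, ofHom_comp, ofHom_comp, ofHom_comp,
      BraidedCategory.hexagon_reverse]
  symmetry a b := by
    change ofHom (β_ a.of b.of).hom ≫ ofHom (β_ b.of a.of).hom = 𝟙 (Tilde.ob (a.of ⊗ b.of))
    rw [ofHom_comp, SymmetricCategory.symmetry, ← ofHom_id]

instance [UnitIsInitial M] : UnitIsInitial (Tilde M) where
  nonempty_isInitial := ⟨IsInitial.ofUniqueHom
    (fun b => ofHom (a := ⟨𝟙_ M⟩) (fromUnit b.of)) (fun b ξ => by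
      obtain ⟨t, f, rfl⟩ := mk_surjective ξ
      exact (mk_eq (fromUnit t) _ _ (fromUnit_unique _ _)).symm)⟩

end
end Tilde

section Functors

variable (M : Type w) [SmallCategory M] [MonoidalCategory M] [SymmetricCategory M]
  [UnitIsInitial M]
variable (A : Type u) [Category.{v} A] [Abelian A]

variable {M} in
/-- The translation functor `τ_x`: precomposition with `x ⊗ -`. -/
def translation (x : M) : (M ⥤ A) ⥤ (M ⥤ A) :=
  (Functor.whiskeringLeft M M A).obj (tensorLeft x)

variable {M} in
/-- The natural transformation of endofunctors `t ≅ 𝟙_ ⊗ t ⟶ x ⊗ t` of `M`. -/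
noncomputable def unitToTensorLeft (x : M) : 𝟭 M ⟶ tensorLeft x where
  app t := (λ_ t).inv ≫ fromUnit x ▷ t
  naturality t t' f := by
    change f ≫ (λ_ t').inv ≫ fromUnit x ▷ t' = ((λ_ t).inv ≫ fromUnit x ▷ t) ≫ x ◁ f
    rw [Category.assoc, ← whisker_exchange, leftUnitor_inv_naturality_assoc]

variable {M} in
/-- The natural transformation `i_x : Id ⟶ τ_x`, induced by `𝟙_ ⟶ x`. -/
noncomputable def iota (x : M) : 𝟭 (M ⥤ A) ⟶ translation A x where
  app F := Functor.whiskerRight (unitToTensorLeft x) F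
  naturality F G f := by
    ext t
    exact (f.naturality _).symm

variable {M A} in
/-- `κ_x(F)`, the kernel of `i_x(F) : F ⟶ τ_x(F)`. -/
noncomputable def kappa (x : M) (F : M ⥤ A) : M ⥤ A := kernel ((iota A x).app F)

variable {M A} in
/-- The inclusion of `κ_x(F)` in `F`. -/
noncomputable def kappaι (x : M) (F : M ⥤ A) : kappa x F ⟶ F := kernel.ι ((iota A x).app F)

variable {M} in
/-- The difference functor `δ_x`: the cokernel of `i_x : Id ⟶ τ_x`. -/
noncomputable def difference (x : M) : (M ⥤ A) ⥤ (M ⥤ A) where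
  obj F := cokernel ((iota A x).app F)
  map {F G} f := cokernel.map _ _ f ((translation A x).map f) ((iota A x).naturality f).symm
  map_id F := by simp [← cancel_epi (cokernel.π ((iota A x).app F))]
  map_comp {F G H} f g := by simp [← cancel_epi (cokernel.π ((iota A x).app F))]

section

variable [IsGrothendieckAbelian.{w} A]

/-- `F` is stably zero if it is the sum of its subfunctors `κ_x(F)`, for all objects `x` of `M`,
that is, if the image of `⨁ κ_x(F) ⟶ F` is all of `F`. -/
def stablyZero : ObjectProperty (M ⥤ A) :=
  fun F => IsIso (Abelian.image.ι (Sigma.desc (fun x : M => kappaι x F)))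

variable {M A}

theorem stablyZero_iff (F : M ⥤ A) :
    stablyZero M A F ↔ ∀ ⦃G : M ⥤ A⦄ (g : F ⟶ G), (∀ x : M, kappaι x F ≫ g = 0) → g = 0 := by
  have h : stablyZero M A F ↔ Epi (Sigma.desc (fun x : M => kappaι x F)) := by
    constructor
    · intro (h : IsIso _)
      rw [← Abelian.image.fac (Sigma.desc (fun x : M => kappaι x F))]
      infer_instance
    · intro h
      rw [← Abelian.image.fac (Sigma.desc (fun x : M => kappaι x F))] at h
      have := epi_of_epi (Abelian.factorThruImage (Sigma.desc (fun x : M => kappaι x F)))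
        (Abelian.image.ι _)
      exact isIso_of_mono_of_epi (Abelian.image.ι (Sigma.desc (fun x : M => kappaι x F)))
  rw [h, Preadditive.epi_iff_cancel_zero]
  refine forall_congr' fun G => forall_congr' fun g => ?_
  constructor
  · intro h1 h2
    exact h1 (by ext x : 1; simpa using h2 x)
  · intro h1 h2
    refine h1 fun x => ?_
    simpa using Sigma.ι (fun x : M => kappa x F) x ≫= h2

theorem kappaι_iota (x : M) (F : M ⥤ A) : kappaι x F ≫ (iota A x).app F = 0 :=
  kernel.condition _

variable (A) in
/-- The natural transformation `τ_x ⟶ τ_y` induced by a morphism `x ⟶ y`. -/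
def translationMap {x y : M} (f : x ⟶ y) : translation A x ⟶ translation A y :=
  (Functor.whiskeringLeft M M A).map ((tensoringLeft M).map f)

theorem iota_comp_map {x y : M} (f : x ⟶ y) (F : M ⥤ A) :
    (iota A x).app F ≫ (translationMap A f).app F = (iota A y).app F := by
  have h : fromUnit x ≫ f = fromUnit y := fromUnit_unique _ _
  ext t
  change F.map ((λ_ t).inv ≫ fromUnit x ▷ t) ≫ F.map (f ▷ t) =
    F.map ((λ_ t).inv ≫ fromUnit y ▷ t)
  rw [← F.map_comp, ← h, comp_whiskerRight, Category.assoc]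

theorem iota_eq_zero_of_hom {x y : M} (f : x ⟶ y) {D F : M ⥤ A} (d : D ⟶ F)
    (h : d ≫ (iota A x).app F = 0) : d ≫ (iota A y).app F = 0 := by
  rw [← iota_comp_map f F, reassoc_of% h, zero_comp]

instance (x : M) (F : M ⥤ A) : Mono (kappaι x F) :=
  inferInstanceAs (Mono (kernel.ι ((iota A x).app F)))

/-- The universal property of `κ_x(F)`. -/
noncomputable def kappaLift {x : M} {D F : M ⥤ A} (d : D ⟶ F) (h : d ≫ (iota A x).app F = 0) :
    D ⟶ kappa x F :=
  kernel.lift _ d h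

theorem kappaLift_ι {x : M} {D F : M ⥤ A} (d : D ⟶ F) (h : d ≫ (iota A x).app F = 0) :
    kappaLift d h ≫ kappaι x F = d :=
  kernel.lift_ι _ _ _

theorem iota_naturality (x : M) {F G : M ⥤ A} (f : F ⟶ G) :
    f ≫ (iota A x).app G = (iota A x).app F ≫ (translation A x).map f :=
  (iota A x).naturality f

variable (M) in
/-- The objects of `M`, preordered by the existence of a morphism. -/
structure Objects : Type w where
  /-- The element given by an object. -/
  ob ::
  /-- The underlying object. -/
  of : M

instance : Preorder (Objects M) where
  le x y := Nonempty (x.of ⟶ y.of)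
  le_refl x := ⟨𝟙 _⟩
  le_trans x y z := fun ⟨f⟩ ⟨g⟩ => ⟨f ≫ g⟩

instance : IsDirectedOrder (Objects M) where
  directed x y := ⟨⟨x.of ⊗ y.of⟩, ⟨(ρ_ _).inv ≫ x.of ◁ fromUnit y.of⟩,
    ⟨(λ_ _).inv ≫ fromUnit x.of ▷ y.of⟩⟩

instance : Nonempty (Objects M) := ⟨⟨𝟙_ M⟩⟩

/-- The directed system of the `κ_x(F)`. -/
noncomputable def kappaSystem (F : M ⥤ A) : Objects M ⥤ (M ⥤ A) where
  obj x := kappa x.of F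
  map {x y} f := kappaLift (kappaι x.of F)
    (iota_eq_zero_of_hom (leOfHom f).some _ (kappaι_iota _ _))
  map_id x := by
    rw [← cancel_mono (kappaι x.of F), kappaLift_ι, Category.id_comp]
  map_comp {x y z} f g := by
    rw [← cancel_mono (kappaι z.of F), Category.assoc, kappaLift_ι, kappaLift_ι, kappaLift_ι]

/-- The inclusions of the `κ_x(F)`. -/
noncomputable def kappaCocone (F : M ⥤ A) : Cocone (kappaSystem F) where
  pt := F
  ι := { app x := kappaι x.of F
         naturality x y f := (kappaLift_ι _ _).trans (Category.comp_id _).symm }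

theorem nonempty_isColimit (F : M ⥤ A) (hF : stablyZero M A F) :
    Nonempty (IsColimit (kappaCocone F)) := by
  have : CategoryTheory.IsConnected (Objects M) := IsFiltered.isConnected _
  let c := colimit.cocone (kappaSystem F)
  have hm : ∀ x : Objects M, Mono ((kappaCocone F).ι.app x) := fun x =>
    inferInstanceAs (Mono (kappaι x.of F))
  have hmono : Mono ((colimit.isColimit (kappaSystem F)).desc (kappaCocone F)) := by
    have := hm
    have := NatTrans.mono_of_mono_app (kappaCocone F).ι
    have h := colim.map_mono' (kappaCocone F).ι (colimit.isColimit (kappaSystem F))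
      (isColimitConstCocone (Objects M) F)
      ((colimit.isColimit (kappaSystem F)).desc (kappaCocone F)) (fun j => ((colimit.isColimit (kappaSystem F)).fac _ j).trans (Category.comp_id _).symm)
    exact h
  have hepi : Epi ((colimit.isColimit (kappaSystem F)).desc (kappaCocone F)) := by
    rw [Preadditive.epi_iff_cancel_zero]
    intro G g hg
    refine (stablyZero_iff F).1 hF g fun x => ?_
    have := (colimit.isColimit (kappaSystem F)).fac (kappaCocone F) ⟨x⟩
    change _ = kappaι x F at this
    rw [← this]
    exact (Category.assoc _ _ _).trans ((congrArg _ hg).trans comp_zero)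
  have := isIso_of_mono_of_epi ((colimit.isColimit (kappaSystem F)).desc (kappaCocone F))
  exact ⟨IsColimit.ofPointIso (colimit.isColimit (kappaSystem F))⟩

theorem stablyZero_cover (T : (M ⥤ A) ⥤ (M ⥤ A)) [T.PreservesZeroMorphisms]
    [PreservesColimitsOfShape (Objects M) T] {F : M ⥤ A} (hF : stablyZero M A F)
    {E G : M ⥤ A} (φ : E ⟶ T.obj F) (g : E ⟶ G)
    (h : ∀ (x : M) (D : M ⥤ A) (d : D ⟶ E), d ≫ φ ≫ T.map ((iota A x).app F) = 0 → d ≫ g = 0) :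
    g = 0 := by
  have : CategoryTheory.IsConnected (Objects M) := IsFiltered.isConnected _
  obtain ⟨hc⟩ := nonempty_isColimit F hF
  refine ((isColimitOfPreserves T hc).pullbackOfHasExactColimitsOfShape φ).hom_ext fun j => ?_
  rw [← cancel_epi (pullbackObjIso _ _ _).inv, comp_zero, comp_zero]
  have := h j.of _ (pullback.snd (T.map (kappaι j.of F)) φ) (by
    rw [← pullback.condition_assoc, ← T.map_comp, kappaι_iota, T.map_zero, comp_zero])
  simpa using! this

variable (A) in
/-- The isomorphism `τ_{y ⊗ x} ≅ τ_x τ_y`. -/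
def translationTensorIso (x y : M) :
    translation A (y ⊗ x) ≅ translation A y ⋙ translation A x :=
  (Functor.whiskeringLeft M M A).mapIso (tensorLeftTensor y x)

theorem iota_iota (x y : M) (F : M ⥤ A) :
    (iota A x).app F ≫ (translation A x).map ((iota A y).app F) =
      (iota A (y ⊗ x)).app F ≫ (translationTensorIso A x y).hom.app F := by
  ext t
  have h : fromUnit (y ⊗ x) = fromUnit x ≫ (λ_ x).inv ≫ fromUnit y ▷ x := fromUnit_unique _ _
  change F.map ((λ_ t).inv ≫ fromUnit x ▷ t) ≫ F.map ((λ_ (x ⊗ t)).inv ≫ fromUnit y ▷ (x ⊗ t)) =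
    F.map ((λ_ t).inv ≫ fromUnit (y ⊗ x) ▷ t) ≫ F.map (α_ y x t).hom
  rw [← F.map_comp, ← F.map_comp, h]
  simp

variable (A) in
/-- The isomorphism `τ_x τ_y ≅ τ_y τ_x`. -/
def translationSwap (x y : M) :
    translation A y ⋙ translation A x ≅ translation A x ⋙ translation A y :=
  (translationTensorIso A x y).symm ≪≫
    (Functor.whiskeringLeft M M A).mapIso ((tensoringLeft M).mapIso (β_ y x)) ≪≫
      translationTensorIso A y x

theorem iota_translation (x y : M) (F : M ⥤ A) :
    (iota A y).app ((translation A x).obj F) =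
      (translation A x).map ((iota A y).app F) ≫ (translationSwap A x y).hom.app F := by
  ext t
  change F.map (x ◁ ((λ_ t).inv ≫ fromUnit y ▷ t)) =
    F.map ((λ_ (x ⊗ t)).inv ≫ fromUnit y ▷ (x ⊗ t)) ≫
      F.map (α_ y x t).inv ≫ F.map ((β_ y x).hom ▷ t) ≫ F.map (α_ x y t).hom
  rw [← F.map_comp, ← F.map_comp, ← F.map_comp]
  congr 1
  rw [← cancel_mono (α_ x y t).inv]
  simp only [MonoidalCategory.whiskerLeft_comp, Category.assoc, Iso.hom_inv_id, Category.comp_id,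
    associator_inv_naturality_middle, associator_inv_naturality_left_assoc,
    leftUnitor_tensor_inv, Iso.hom_inv_id_assoc, ← comp_whiskerRight]
  rw [BraidedCategory.braiding_naturality_left]
  simp

instance (x : M) : PreservesColimitsOfSize.{w, w} (translation A x) :=
  inferInstanceAs (PreservesColimitsOfSize.{w, w} ((Functor.whiskeringLeft M M A).obj _))

instance (x : M) : PreservesFiniteColimits (translation A x) :=
  inferInstanceAs (PreservesFiniteColimits ((Functor.whiskeringLeft M M A).obj _))

instance (x : M) : PreservesFiniteLimits (translation A x) :=
  inferInstanceAs (PreservesFiniteLimits ((Functor.whiskeringLeft M M A).obj _))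

instance (x : M) : (translation A x).Additive :=
  inferInstanceAs ((Functor.whiskeringLeft M M A).obj _).Additive

theorem stablyZero_iff_cover {F : M ⥤ A} :
    stablyZero M A F ↔ ∀ ⦃E G : M ⥤ A⦄ (φ : E ⟶ F) (g : E ⟶ G),
      (∀ (x : M) (D : M ⥤ A) (d : D ⟶ E), d ≫ φ ≫ (iota A x).app F = 0 → d ≫ g = 0) → g = 0 := by
  constructor
  · intro hF E G φ g h
    exact stablyZero_cover (𝟭 _) hF φ g h
  · intro h
    rw [stablyZero_iff]
    intro G g hg
    refine h (𝟙 F) g fun x D d hd => ?_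
    rw [Category.id_comp] at hd
    rw [← kappaLift_ι d hd, Category.assoc, hg x, comp_zero]

theorem stablyZero_translation (x : M) {F : M ⥤ A} (hF : stablyZero M A F) :
    stablyZero M A ((translation A x).obj F) := by
  rw [stablyZero_iff_cover]
  intro E G φ g h
  refine stablyZero_cover (translation A x) hF φ g fun y D d hd => h y D d ?_
  rw [iota_translation, reassoc_of% hd, zero_comp]

instance : (stablyZero M A).ContainsZero where
  exists_zero := by
    obtain ⟨Z, hZ⟩ := HasZeroObject.zero (C := M ⥤ A)
    refine ⟨Z, hZ, ?_⟩
    rw [stablyZero_iff]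
    intro G g _
    exact hZ.eq_of_src _ _

instance : (stablyZero M A).IsClosedUnderSubobjects where
  prop_of_mono {F' F} m _ hF := by
    rw [stablyZero_iff_cover]
    intro E G φ g h
    refine stablyZero_iff_cover.1 hF (φ ≫ m) g fun x D d hd => h x D d ?_
    rw [← cancel_mono ((translation A x).map m), zero_comp, Category.assoc, Category.assoc,
      ← iota_naturality, ← hd, Category.assoc]

instance : (stablyZero M A).IsClosedUnderQuotients where
  prop_of_epi {F F''} p _ hF := by
    rw [stablyZero_iff_cover]
    intro E G φ g h
    rw [← cancel_epi (pullback.fst φ p), comp_zero]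
    refine stablyZero_iff_cover.1 hF (pullback.snd φ p) _ fun x D d hd => ?_
    rw [← Category.assoc]
    refine h x D _ ?_
    rw [Category.assoc, pullback.condition_assoc, iota_naturality, reassoc_of% hd, zero_comp]

instance : (stablyZero M A).IsClosedUnderExtensions where
  prop_X₂_of_shortExact {S} hS h₁ h₃ := by
    have := hS.mono_f
    rw [stablyZero_iff_cover]
    intro E G φ g h
    refine stablyZero_iff_cover.1 h₃ (φ ≫ S.g) g fun x D d hd => ?_
    have hS' := hS.map_of_exact (translation A x)
    have hz : (d ≫ φ ≫ (iota A x).app S.X₂) ≫ (translation A x).map S.g = 0 := by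
      rw [Category.assoc, Category.assoc, ← iota_naturality, ← hd, Category.assoc]
    have hm := hS'.mono_f
    obtain ⟨l, hl⟩ : ∃ l : D ⟶ (translation A x).obj S.X₁,
        l ≫ (translation A x).map S.f = d ≫ φ ≫ (iota A x).app S.X₂ :=
      ⟨hS'.exact.lift _ hz, hS'.exact.lift_f _ hz⟩
    refine stablyZero_cover (translation A x) h₁ l (d ≫ g) fun y D' d' hd' => ?_
    rw [← Category.assoc]
    refine h (y ⊗ x) D' (d' ≫ d) ?_
    rw [← cancel_mono ((translationTensorIso A x y).hom.app S.X₂), zero_comp]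
    simp only [Category.assoc]
    rw [← iota_iota, ← reassoc_of% hl, ← Functor.map_comp, iota_naturality, Functor.map_comp,
      reassoc_of% hd', zero_comp]

instance : (stablyZero M A).IsSerreClass where

end

end Functors

section Stable

variable (M : Type w) [SmallCategory M] [MonoidalCategory M] [SymmetricCategory M]
  [UnitIsInitial M]
variable (A : Type u) [Category.{v} A] [Abelian A] [IsGrothendieckAbelian.{w} A]

/-- The category `St(M, A)`: the quotient (in the sense of Gabriel) of the abelian category of
functors `M ⥤ A` by the Serre subcategory of stably zero functors. -/
abbrev St := (stablyZero M A).isoModSerre.Localization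

/-- The canonical functor from `M ⥤ A` to `St(M, A)`. -/
abbrev stQ : (M ⥤ A) ⥤ St M A := (stablyZero M A).isoModSerre.Q

noncomputable instance : Abelian (St M A) :=
  ObjectProperty.SerreClassLocalization.abelian (stQ M A) (stablyZero M A)

instance : PreservesFiniteLimits (stQ M A) :=
  ObjectProperty.SerreClassLocalization.preservesFiniteLimits (stQ M A) (stablyZero M A)

instance : PreservesFiniteColimits (stQ M A) :=
  ObjectProperty.SerreClassLocalization.preservesFiniteColimits (stQ M A) (stablyZero M A)

variable {M A}

theorem isZero_stQ_obj_iff (F : M ⥤ A) : IsZero ((stQ M A).obj F) ↔ stablyZero M A F :=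
  ObjectProperty.SerreClassLocalization.isZero_obj_iff (stQ M A) (stablyZero M A) F

theorem stablyZero_kappa (x : M) (F : M ⥤ A) : stablyZero M A (kappa x F) := by
  rw [stablyZero_iff_cover]
  intro E G φ g h
  have h1 := h x E (𝟙 E) (by
    rw [← cancel_mono ((translation A x).map (kappaι x F))]
    simp only [Category.assoc, zero_comp]
    rw [← iota_naturality, kappaι_iota, comp_zero, comp_zero])
  rwa [Category.id_comp] at h1

/-- The projection `τ_x(F) ⟶ δ_x(F)`. -/
noncomputable def differenceπ (x : M) (F : M ⥤ A) :
    (translation A x).obj F ⟶ (difference A x).obj F :=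
  cokernel.π ((iota A x).app F)

instance (x : M) (F : M ⥤ A) : Epi (differenceπ x F) :=
  inferInstanceAs (Epi (cokernel.π ((iota A x).app F)))

theorem iota_differenceπ (x : M) (F : M ⥤ A) : (iota A x).app F ≫ differenceπ x F = 0 :=
  cokernel.condition _

theorem differenceπ_naturality (x : M) {F G : M ⥤ A} (f : F ⟶ G) :
    differenceπ x F ≫ (difference A x).map f = (translation A x).map f ≫ differenceπ x G :=
  cokernel.π_desc _ _ _

instance (x : M) : (difference A x).Additive where
  map_add {F G f g} := by
    rw [← cancel_epi (differenceπ x F), Preadditive.comp_add, differenceπ_naturality,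
      differenceπ_naturality, differenceπ_naturality, Functor.map_add, Preadditive.add_comp]

theorem stablyZero_difference (x : M) {F : M ⥤ A} (hF : stablyZero M A F) :
    stablyZero M A ((difference A x).obj F) :=
  (stablyZero M A).prop_of_epi (differenceπ x F) (stablyZero_translation x hF)

/-- The morphism of short complexes given by `i_x`. -/
noncomputable def snakeMap (x : M) (S : ShortComplex (M ⥤ A)) : S ⟶ S.map (translation A x) where
  τ₁ := (iota A x).app S.X₁
  τ₂ := (iota A x).app S.X₂
  τ₃ := (iota A x).app S.X₃
  comm₁₂ := (iota_naturality x S.f).symm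
  comm₂₃ := (iota_naturality x S.g).symm

/-- The morphism of short complexes given by the projection of `τ_x` to `δ_x`. -/
noncomputable def snakeMap' (x : M) (S : ShortComplex (M ⥤ A)) :
    S.map (translation A x) ⟶ S.map (difference A x) where
  τ₁ := differenceπ x S.X₁
  τ₂ := differenceπ x S.X₂
  τ₃ := differenceπ x S.X₃
  comm₁₂ := differenceπ_naturality x S.f
  comm₂₃ := differenceπ_naturality x S.g

theorem snakeMap_comp (x : M) (S : ShortComplex (M ⥤ A)) : snakeMap x S ≫ snakeMap' x S = 0 := by
  ext1
  · exact iota_differenceπ x S.X₁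
  · exact iota_differenceπ x S.X₂
  · exact iota_differenceπ x S.X₃

/-- The snake diagram given by `i_x` and a short exact sequence. -/
noncomputable def snake (x : M) (S : ShortComplex (M ⥤ A)) (hS : S.ShortExact) :
    ShortComplex.SnakeInput (M ⥤ A) where
  L₀ := kernel (snakeMap x S)
  L₁ := S
  L₂ := S.map (translation A x)
  L₃ := S.map (difference A x)
  v₀₁ := kernel.ι _
  v₁₂ := snakeMap x S
  v₂₃ := snakeMap' x S
  w₀₂ := kernel.condition _
  w₁₃ := snakeMap_comp x S
  h₀ := kernelIsKernel (snakeMap x S)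
  h₃ := ShortComplex.isColimitOfIsColimitπ _
    ((CokernelCofork.isColimitMapCoconeEquiv _ _).symm
      (cokernelIsCokernel ((iota A x).app S.X₁)))
    ((CokernelCofork.isColimitMapCoconeEquiv _ _).symm
      (cokernelIsCokernel ((iota A x).app S.X₂)))
    ((CokernelCofork.isColimitMapCoconeEquiv _ _).symm
      (cokernelIsCokernel ((iota A x).app S.X₃)))
  L₁_exact := hS.exact
  epi_L₁_g := hS.epi_g
  L₂_exact := (hS.map_of_exact (translation A x)).exact
  mono_L₂_f := (hS.map_of_exact (translation A x)).mono_f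

theorem shortExact_difference_stQ (x : M) (S : ShortComplex (M ⥤ A)) (hS : S.ShortExact) :
    (S.map (difference A x ⋙ stQ M A)).ShortExact := by
  have hz : IsZero ((stQ M A).obj (snake x S hS).L₀.X₃) := by
    rw [isZero_stQ_obj_iff]
    have hm : Mono (snake x S hS).v₀₁.τ₃ := Fork.IsLimit.mono (snake x S hS).h₀τ₃
    have hk : (snake x S hS).v₀₁.τ₃ ≫ (iota A x).app S.X₃ = 0 := (snake x S hS).w₀₂_τ₃
    have : Mono (kappaLift _ hk) := by
      rw [← kappaLift_ι _ hk] at hm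
      exact mono_of_mono _ (kappaι x _)
    exact (stablyZero M A).prop_of_mono (kappaLift _ hk) (stablyZero_kappa x _)
  have h1 : (S.map (difference A x ⋙ stQ M A)).Exact := (snake x S hS).L₃_exact.map (stQ M A)
  have h2 : Mono ((stQ M A).map ((difference A x).map S.f)) :=
    ((snake x S hS).L₂'_exact.map (stQ M A)).mono_g (hz.eq_of_src _ _)
  have h3 : Epi ((difference A x).map S.g) := by
    have := hS.epi_g
    have h4 : Epi (differenceπ x S.X₂ ≫ (difference A x).map S.g) := by
      rw [differenceπ_naturality]
      infer_instance
    exact epi_of_epi (differenceπ x S.X₂) _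
  exact { exact := h1
          mono_f := h2
          epi_g := inferInstanceAs (Epi ((stQ M A).map ((difference A x).map S.g))) }

theorem exact_difference_stQ (x : M) :
    PreservesFiniteLimits (difference A x ⋙ stQ M A) ∧
      PreservesFiniteColimits (difference A x ⋙ stQ M A) :=
  ((Functor.exact_tfae (difference A x ⋙ stQ M A)).out 0 3).1 (shortExact_difference_stQ x)

theorem isInvertedBy_difference_stQ (x : M) :
    (stablyZero M A).isoModSerre.IsInvertedBy (difference A x ⋙ stQ M A) := by
  have h := exact_difference_stQ (A := A) x
  have := h.1
  have := h.2
  rw [ObjectProperty.isoModSerre_isInvertedBy_iff]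
  intro F hF
  exact (isZero_stQ_obj_iff _).2 (stablyZero_difference x hF)

variable (A) in
/-- The functor `δ_x : St(M, A) ⥤ St(M, A)` induced by the difference functor `δ_x`. -/
noncomputable def stDifference (x : M) : St M A ⥤ St M A :=
  Localization.lift (difference A x ⋙ stQ M A) (isInvertedBy_difference_stQ x) (stQ M A)

variable (A) in
/-- The functor `δ_x` of `St(M, A)` is induced by the difference functor `δ_x`. -/
noncomputable def stDifferenceIso (x : M) :
    stQ M A ⋙ stDifference A x ≅ difference A x ⋙ stQ M A :=
  Localization.fac _ (isInvertedBy_difference_stQ x) _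

theorem exact_stDifference (x : M) :
    PreservesFiniteLimits (stDifference A x) ∧ PreservesFiniteColimits (stDifference A x) := by
  have h := exact_difference_stQ (A := A) x
  have := h.1
  have := h.2
  have h1 : PreservesFiniteLimits (stQ M A ⋙ stDifference A x) :=
    preservesFiniteLimits_of_natIso (stDifferenceIso A x).symm
  have h2 : PreservesFiniteColimits (stQ M A ⋙ stDifference A x) :=
    preservesFiniteColimits_of_natIso (stDifferenceIso A x).symm
  exact ⟨(ObjectProperty.SerreClassLocalization.preservesFiniteLimits_comp_iff _
      (stablyZero M A) _).1 h1,
    (ObjectProperty.SerreClassLocalization.preservesFiniteColimits_comp_iff _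
      (stablyZero M A) _).1 h2⟩

instance (x : M) : PreservesFiniteLimits (stDifference A x) := (exact_stDifference x).1

instance (x : M) : PreservesFiniteColimits (stDifference A x) := (exact_stDifference x).2

end Stable

section SerreClass

variable {C : Type u} [Category.{v} C] [Abelian C] (P : ObjectProperty C) [P.IsSerreClass]

instance : P.IsClosedUnderLimitsOfShape (Discrete.{0} PEmpty) where
  limitsOfShape_le := by
    rintro X ⟨p⟩
    refine P.prop_of_isZero ?_
    rw [IsZero.iff_id_eq_zero]
    exact p.isLimit.hom_ext (by rintro ⟨⟨⟩⟩)

instance : P.IsClosedUnderBinaryProducts where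
  limitsOfShape_le := by
    rintro X ⟨p⟩
    refine P.prop_of_iso ?_ (P.prop_X₂_of_shortExact
      (ShortComplex.Splitting.ofHasBinaryBiproduct _ _).shortExact
      (p.prop_diag_obj (.mk .left)) (p.prop_diag_obj (.mk .right)))
    exact IsLimit.conePointUniqueUpToIso (BinaryBiproduct.isLimit _ _)
      ((IsLimit.postcomposeHomEquiv (diagramIsoPair p.diag) _).2 p.isLimit)

instance : P.IsClosedUnderFiniteProducts := ObjectProperty.IsClosedUnderFiniteProducts.mk'

instance : PreservesFiniteLimits P.ι :=
  ((Functor.preservesFiniteLimits_tfae P.ι).out 2 3).1 P.preservesKernels_ι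

instance : PreservesFiniteColimits P.ι :=
  ((Functor.preservesFiniteColimits_tfae P.ι).out 2 3).1 P.preservesCokernels_ι

end SerreClass

section Polynomial

variable (M : Type w) [SmallCategory M] [MonoidalCategory M] [SymmetricCategory M]
  [UnitIsInitial M]
variable (A : Type u) [Category.{v} A] [Abelian A] [IsGrothendieckAbelian.{w} A]

/-- Auxiliary definition for `Pol`, with the degree shifted by one. -/
def polAux : ℕ → ObjectProperty (St M A)
  | 0 => IsZero
  | k + 1 => fun X => ∀ x : M, polAux k ((stDifference A x).obj X)

/-- The polynomial objects of degree at most `n` of `St(M, A)`, for an integer `n`: the zero objects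
if `n < 0`; otherwise the objects `X` such that `δ_x(X)` is polynomial of degree at most `n - 1`
for all `x`. -/
def Pol (n : ℤ) : ObjectProperty (St M A) := polAux M A (n + 1).toNat

variable {M A} in
theorem pol_iff_of_neg {n : ℤ} (hn : n < 0) (X : St M A) : Pol M A n X ↔ IsZero X := by
  rw [Pol, Int.toNat_of_nonpos (by omega)]
  rfl

variable {M A} in
theorem pol_iff_of_nonneg {n : ℤ} (hn : 0 ≤ n) (X : St M A) :
    Pol M A n X ↔ ∀ x : M, Pol M A (n - 1) ((stDifference A x).obj X) := by
  obtain ⟨k, rfl⟩ := Int.eq_ofNat_of_zero_le hn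
  rw [Pol, show ((k : ℤ) + 1).toNat = k + 1 by omega]
  simp only [Pol, show ((k : ℤ) - 1 + 1).toNat = k by omega]
  rfl

instance isSerreClass_polAux (k : ℕ) : (polAux M A k).IsSerreClass := by
  induction k with
  | zero => exact inferInstanceAs (ObjectProperty.IsSerreClass (IsZero (C := St M A)))
  | succ k ih =>
    have h : ∀ x : M, ((polAux M A k).inverseImage (stDifference A x)).IsSerreClass :=
      fun x => inferInstance
    exact
      { exists_zero := by
          obtain ⟨Z, hZ⟩ := HasZeroObject.zero (C := St M A)
          exact ⟨Z, hZ, fun x => ((polAux M A k).inverseImage (stDifference A x)).prop_of_isZero hZ⟩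
        prop_of_mono := fun f _ hY x =>
          ((polAux M A k).inverseImage (stDifference A x)).prop_of_mono f (hY x)
        prop_of_epi := fun f _ hX x =>
          ((polAux M A k).inverseImage (stDifference A x)).prop_of_epi f (hX x)
        prop_X₂_of_shortExact := fun hS h₁ h₃ x =>
          ((polAux M A k).inverseImage (stDifference A x)).prop_X₂_of_shortExact hS (h₁ x) (h₃ x) }

instance (n : ℤ) : (Pol M A n).IsSerreClass := isSerreClass_polAux M A _

/-- The quotient category `Pol_n(M, A) / Pol_{n-1}(M, A)`: the quotient (in the sense of Gabriel)
of the abelian category of polynomial objects of degree at most `n` of `St(M, A)` by the Serre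
subcategory of those that are of degree at most `n - 1`. -/
abbrev PolQuot (n : ℤ) := ((Pol M A (n - 1)).inverseImage (Pol M A n).ι).isoModSerre.Localization

/-- The canonical functor from `Pol_n(M, A)` to `Pol_n(M, A) / Pol_{n-1}(M, A)`. -/
noncomputable abbrev polQuotQ (n : ℤ) : (Pol M A n).FullSubcategory ⥤ PolQuot M A n :=
  ((Pol M A (n - 1)).inverseImage (Pol M A n).ι).isoModSerre.Q

/-- The functors `M ⥤ A` whose image in `St(M, A)` is polynomial of degree at most `n`. -/
abbrev IsPol (n : ℤ) : ObjectProperty (M ⥤ A) := (Pol M A n).inverseImage (stQ M A)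

/-- The canonical functor to `Pol_n(M, A) / Pol_{n-1}(M, A)` from the category of the functors
`M ⥤ A` whose image in `St(M, A)` is polynomial of degree at most `n`. -/
noncomputable def toPolQuot (n : ℤ) : (IsPol M A n).FullSubcategory ⥤ PolQuot M A n :=
  (Pol M A n).lift ((IsPol M A n).ι ⋙ stQ M A) (fun F => F.property) ⋙ polQuotQ M A n

end Polynomial

/-- A functor `Φ` from the functors `M ⥤ A` to the functors `N ⥤ A` induces the functor `E` from
`Pol_n(M, A) / Pol_{n-1}(M, A)` to `Pol_n(N, A) / Pol_{n-1}(N, A)`: it sends the functors whose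
image in `St(M, A)` is polynomial of degree at most `n` to functors whose image in `St(N, A)` is
polynomial of degree at most `n`, and its restriction to these functors commutes, up to a natural
isomorphism, with `E` and the canonical functors to the quotient categories. -/
def Induces {M : Type w} [SmallCategory M] [MonoidalCategory M] [SymmetricCategory M]
    [UnitIsInitial M] {N : Type w} [SmallCategory N] [MonoidalCategory N] [SymmetricCategory N]
    [UnitIsInitial N] {A : Type u} [Category.{v} A] [Abelian A] [IsGrothendieckAbelian.{w} A]
    (Φ : (M ⥤ A) ⥤ (N ⥤ A)) (n : ℤ) (E : PolQuot M A n ⥤ PolQuot N A n) : Prop :=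
  ∃ h : ∀ F : (IsPol M A n).FullSubcategory, IsPol N A n (Φ.obj F.obj),
    Nonempty ((IsPol N A n).lift ((IsPol M A n).ι ⋙ Φ) h ⋙ toPolQuot N A n ≅
      toPolQuot M A n ⋙ E)

/-- The functor `η*`: precomposition with the canonical functor `M ⥤ M~`. -/
abbrev etaStar (M : Type w) [SmallCategory M] [MonoidalCategory M]
    (A : Type u) [Category.{v} A] : (Tilde M ⥤ A) ⥤ (M ⥤ A) :=
  (Functor.whiskeringLeft M (Tilde M) A).obj (Tilde.eta M)

/-- The functor `α`, left adjoint to `η*`: the left Kan extension along the canonical functor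
`M ⥤ M~`. -/
noncomputable abbrev alpha (M : Type w) [SmallCategory M] [MonoidalCategory M]
    (A : Type u) [Category.{v} A] [HasColimitsOfSize.{w, w} A] : (M ⥤ A) ⥤ (Tilde M ⥤ A) :=
  (Tilde.eta M).lan

/-! The theorem rests on two facts about the adjunction between `α` and `η*`. First, `η*` preserves
and reflects polynomial degree. It is exact, is the identity on objects and commutes with `τ_x` and
`δ_x`. In `M~` every object `x` maps to the unit, so each `i_x` is a monomorphism, both on a functor
`G` on `M~` and on `η* G`; hence for either of them stably zero means zero. Induction through `δ_x`
does the rest (`polFun_etaStar_iff`). Second, `η* α F` is the colimit over `t` in `M` of the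
translates `τ_t F`, because the objects `t ⊗ b ⟶ b` are final in the comma category computing `(α
F)(b)` (`final_projFunctor`, `isColimitLan`). As `M` is connected, `F` is the colimit of the
constant diagram on `F`, and the unit `F ⟶ η* α F` is the colimit of the maps `i_t`. If `F` has
degree at most `n`, then `i_t` has the stably zero kernel `κ_t F` and the cokernel `δ_t F` of degree
less than `n`, so it is an isomorphism modulo degree less than `n`. Such maps are stable under all
small colimits, although colimits over `M` need not be exact
(`isStableUnderColimitsOfShape_isoModSerre`). So the unit is an isomorphism modulo lower degree
(`isoModSerre_lanUnit`). By a triangle identity and two-out-of-three, `η*` of the counit is one too;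
since `η*` reflects these maps, so is the counit. No exactness of `α` is needed: the adjunction
descends to the stable categories, restricts to polynomial objects and descends again to the
quotients, where unit and counit become invertible. -/

/-! ### Colimits of isomorphisms modulo a Serre class. -/

section SerreColimits

variable {C : Type*} [Category* C] [Abelian C] (P : ObjectProperty C) [P.IsSerreClass]

/-- If colimits of shape `J` are exact, the isomorphisms modulo a Serre class that is closed under
colimits of shape `J` are stable under colimits of shape `J`. -/
theorem isStableUnderColimitsOfShape_isoModSerre_of_exact (J : Type*) [Category* J]
    [HasColimitsOfShape J C] [HasExactColimitsOfShape J C] [P.IsClosedUnderColimitsOfShape J] :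
    P.isoModSerre.IsStableUnderColimitsOfShape J where
  condition X₁ X₂ c₁ c₂ h₁ h₂ f hf φ hφ := by
    -- For the chosen colimits, exactness makes the kernel and the cokernel of the induced map the
    -- colimits of the pointwise ones. The given cocones are then compared with the chosen ones.
    have hk : P.isoModSerre (colim.map f) := by
      constructor
      · refine P.prop_of_iso (PreservesKernel.iso (colim (J := J) (C := C)) f) ?_
        refine P.prop_colimit _ fun j => ?_
        exact P.prop_of_iso (PreservesKernel.iso ((evaluation J C).obj j) f).symm (hf j).1
      · refine P.prop_of_iso (PreservesCokernel.iso (colim (J := J) (C := C)) f) ?_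
        refine P.prop_colimit _ fun j => ?_
        exact P.prop_of_iso (PreservesCokernel.iso ((evaluation J C).obj j) f).symm (hf j).2
    refine (P.isoModSerre.arrow_mk_iso_iff (Arrow.isoMk
      (h₁.coconePointUniqueUpToIso (colimit.isColimit X₁))
      (h₂.coconePointUniqueUpToIso (colimit.isColimit X₂)) ?_)).2 hk
    refine h₁.hom_ext fun j => ?_
    dsimp
    simp [reassoc_of% (hφ j)]

variable {C' : Type*} [Category* C'] [Abelian C'] in
theorem isoModSerre_inverseImage (F : C' ⥤ C) [PreservesFiniteLimits F] [PreservesFiniteColimits F]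
    {X Y : C'} (f : X ⟶ Y) :
    (P.inverseImage F).isoModSerre f ↔ P.isoModSerre (F.map f) :=
  and_congr (P.prop_iff_of_iso (PreservesKernel.iso F f))
    (P.prop_iff_of_iso (PreservesCokernel.iso F f))

/-- Finite colimits such as coequalizers are not exact, so kernels cannot be computed pointwise.
Instead, the quotient functor preserves finite colimits, and the maps in question are exactly those
that it inverts. -/
theorem isStableUnderColimitsOfShape_isoModSerre_of_finCategory (J : Type) [SmallCategory J]
    [FinCategory J] : P.isoModSerre.IsStableUnderColimitsOfShape J where
  condition X₁ X₂ c₁ c₂ h₁ h₂ f hf φ hφ := by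
    let := ObjectProperty.SerreClassLocalization.abelian P.isoModSerre.Q P
    have := ObjectProperty.SerreClassLocalization.preservesFiniteColimits P.isoModSerre.Q P
    rw [← ObjectProperty.SerreClassLocalization.isIso_map_iff P.isoModSerre.Q P]
    refine MorphismProperty.IsStableUnderColimitsOfShape.condition
      (W := MorphismProperty.isomorphisms P.isoModSerre.Localization) _ _ _ _
      (isColimitOfPreserves P.isoModSerre.Q h₁) (isColimitOfPreserves P.isoModSerre.Q h₂)
      (Functor.whiskerRight f P.isoModSerre.Q) (fun j => ?_) (P.isoModSerre.Q.map φ) (fun j => ?_)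
    · exact (ObjectProperty.SerreClassLocalization.isIso_map_iff P.isoModSerre.Q P _).2 (hf j)
    · exact (P.isoModSerre.Q.map_comp _ _).symm.trans
        ((congrArg _ (hφ j)).trans (P.isoModSerre.Q.map_comp _ _))

section Presentation

variable {J : Type w} [SmallCategory J] [HasCoproducts.{w} C] (X : J ⥤ C)

/-- The sum of the values of a functor at the sources of the morphisms. -/
noncomputable abbrev sumSources : C := ∐ fun f : Σ p : J × J, p.1 ⟶ p.2 => X.obj f.1.1

/-- The first of the two morphisms of which the colimit of a functor is the coequalizer. -/
noncomputable def sumSourcesMap : sumSources X ⟶ ∐ X.obj :=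
  Sigma.desc fun f => X.map f.2 ≫ Sigma.ι X.obj f.1.2

/-- The second of the two morphisms of which the colimit of a functor is the coequalizer. -/
noncomputable def sumSourcesInclusion : sumSources X ⟶ ∐ X.obj :=
  Sigma.desc fun f => Sigma.ι X.obj f.1.1

variable {X}

/-- The cofork given by a cocone. -/
noncomputable def sumCofork (c : Cocone X) : Cofork (sumSourcesMap X) (sumSourcesInclusion X) :=
  Cofork.ofπ (Sigma.desc c.ι.app) (by ext f; simp [sumSourcesMap, sumSourcesInclusion])

/-- The cocone given by a cofork. -/
noncomputable def sumCoforkCocone (s : Cofork (sumSourcesMap X) (sumSourcesInclusion X)) :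
    Cocone X where
  pt := s.pt
  ι := { app := fun j => Sigma.ι X.obj j ≫ s.π
         naturality := fun i j f => by
          have h := Sigma.ι (fun f : Σ p : J × J, p.1 ⟶ p.2 => X.obj f.1.1) ⟨(i, j), f⟩ ≫=
            s.condition
          simp only [sumSourcesMap, sumSourcesInclusion, Sigma.ι_desc_assoc, Category.assoc] at h
          exact h.trans (Category.comp_id _).symm }

/-- The colimit of a functor is a coequalizer of morphisms between coproducts. -/
noncomputable def isColimitSumCofork {c : Cocone X} (hc : IsColimit c) :
    IsColimit (sumCofork c) :=
  Cofork.IsColimit.mk _ (fun s => hc.desc (sumCoforkCocone s))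
    (fun s => by
      ext j
      exact (Sigma.ι_desc_assoc c.ι.app j _).trans (hc.fac (sumCoforkCocone s) j))
    (fun s m hm => hc.hom_ext fun j =>
      ((Sigma.ι_desc_assoc c.ι.app j m).symm.trans (Sigma.ι X.obj j ≫= hm)).trans
        (hc.fac (sumCoforkCocone s) j).symm)

end Presentation

/-- If coproducts are exact, the isomorphisms modulo a Serre class that is closed under
coproducts are stable under colimits. -/
theorem isStableUnderColimitsOfShape_isoModSerre (J : Type w) [SmallCategory J]
    [HasCoproducts.{w} C] [∀ ι : Type w, HasExactColimitsOfShape (Discrete ι) C]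
    [∀ ι : Type w, P.IsClosedUnderColimitsOfShape (Discrete ι)] :
    P.isoModSerre.IsStableUnderColimitsOfShape J where
  condition X₁ X₂ c₁ c₂ h₁ h₂ f hf φ hφ := by
    -- Coproducts are exact, so they are covered by the exact case.
    have hs : ∀ (ι : Type w) (Y₁ Y₂ : ι → C) (g : ∀ i, Y₁ i ⟶ Y₂ i),
        (∀ i, P.isoModSerre (g i)) → P.isoModSerre (Limits.Sigma.map g) := by
      intro ι Y₁ Y₂ g hg
      have := isStableUnderColimitsOfShape_isoModSerre_of_exact P (Discrete ι)
      exact MorphismProperty.colimMap _ fun j => hg j.as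
    have := isStableUnderColimitsOfShape_isoModSerre_of_finCategory P WalkingParallelPair
    -- Any colimit is a coequalizer of two maps between coproducts; the coproducts are handled by
    -- `hs` and the coequalizer by the finite case.
    refine MorphismProperty.IsStableUnderColimitsOfShape.condition (W := P.isoModSerre)
      _ _ _ _ (isColimitSumCofork h₁) (isColimitSumCofork h₂)
      (parallelPairHom _ _ _ _ (Limits.Sigma.map fun i => f.app i.1.1)
        (Limits.Sigma.map fun i => f.app i) ?_ ?_) ?_ φ ?_
    · ext i; simp [sumSourcesMap]
    · ext i; simp [sumSourcesInclusion]
    · rintro (_ | _)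
      · exact hs _ _ _ _ fun i => hf _
      · exact hs _ _ _ _ fun i => hf _
    · have h : Sigma.desc c₁.ι.app ≫ φ =
          Limits.Sigma.map (fun i => f.app i) ≫ Sigma.desc c₂.ι.app := by
        ext j; simp [hφ]
      rintro (_ | _)
      · change (sumSourcesMap X₁ ≫ Sigma.desc c₁.ι.app) ≫ φ =
          Limits.Sigma.map (fun i : Σ p : J × J, p.1 ⟶ p.2 => f.app i.1.1) ≫
            sumSourcesMap X₂ ≫ Sigma.desc c₂.ι.app
        rw [Category.assoc, h]
        ext i
        simp [sumSourcesMap]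
      · exact h

end SerreColimits

/-! ### Polynomial functors before passage to the stable category. -/

section PolynomialFunctors

variable (M : Type w) [SmallCategory M] [MonoidalCategory M] [SymmetricCategory M]
  [UnitIsInitial M]
variable (A : Type u) [Category.{v} A] [Abelian A] [IsGrothendieckAbelian.{w} A]

/-- The functors whose image in `St(M, A)` is polynomial of degree less than `k`. -/
abbrev polFun (k : ℕ) : ObjectProperty (M ⥤ A) := (polAux M A k).inverseImage (stQ M A)

variable {M A}

theorem polFun_zero_iff (F : M ⥤ A) : polFun M A 0 F ↔ stablyZero M A F :=
  isZero_stQ_obj_iff F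

theorem polFun_succ_iff (k : ℕ) (F : M ⥤ A) :
    polFun M A (k + 1) F ↔ ∀ x : M, polFun M A k ((difference A x).obj F) :=
  forall_congr' fun x => (polAux M A k).prop_iff_of_iso ((stDifferenceIso A x).app F)

theorem polFun_le_succ (k : ℕ) : polFun M A k ≤ polFun M A (k + 1) := by
  induction k with
  | zero =>
    intro F hF
    rw [polFun_succ_iff]
    intro x
    rw [polFun_zero_iff] at hF ⊢
    exact stablyZero_difference x hF
  | succ k ih =>
    intro F hF
    rw [polFun_succ_iff] at hF ⊢
    exact fun x => ih _ (hF x)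

theorem polFun_zero_le (k : ℕ) : polFun M A 0 ≤ polFun M A k := by
  induction k with
  | zero => exact le_rfl
  | succ k ih => exact ih.trans (polFun_le_succ k)

/-- `i_x(F)` is an isomorphism modulo the functors of degree less than that of `F`. -/
theorem isoModSerre_iota {k : ℕ} {F : M ⥤ A} (hF : polFun M A (k + 1) F) (x : M) :
    (polFun M A k).isoModSerre ((iota A x).app F) :=
  ⟨polFun_zero_le k _ ((polFun_zero_iff _).2 (stablyZero_kappa x F)),
    (polFun_succ_iff k F).1 hF x⟩

/-- The functors of degree less than `k` are closed under colimits. -/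
theorem polFun_of_isColimit (k : ℕ) {J : Type w} [SmallCategory J] {X : J ⥤ M ⥤ A} {c : Cocone X}
    (hc : IsColimit c) (hX : ∀ j, polFun M A k (X.obj j)) : polFun M A k c.pt := by
  induction k generalizing X with
  | zero =>
    simp only [polFun_zero_iff, stablyZero_iff] at hX ⊢
    intro G g hg
    refine hc.hom_ext fun j => ?_
    rw [comp_zero]
    refine hX j _ fun x => ?_
    -- By naturality of `i_x`, each leg of the cocone carries `κ_x` of the term into `κ_x` of the
    -- colimit, which `g` kills.
    change kappaι x (X.obj j) ≫ (show X.obj j ⟶ c.pt from c.ι.app j) ≫ g = 0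
    generalize (show X.obj j ⟶ c.pt from c.ι.app j) = f
    have h : (kappaι x (X.obj j) ≫ f) ≫ (iota A x).app c.pt = 0 := by
      rw [Category.assoc, iota_naturality, ← Category.assoc, kappaι_iota, zero_comp]
    rw [← Category.assoc, ← kappaLift_ι _ h, Category.assoc, hg, comp_zero]
  | succ k ih =>
    rw [polFun_succ_iff]
    intro x
    have h := ih (colimit.isColimit (X ⋙ difference A x)) fun j =>
      (polFun_succ_iff k _).1 (hX j) x
    -- It is enough that the colimit of the `δ_x(X_j)` surjects onto `δ_x` of the colimit: the
    -- latter is a quotient of `τ_x` of the colimit, and `τ_x` preserves colimits.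
    have : Epi (colimit.desc _ ((difference A x).mapCocone c)) := by
      rw [Preadditive.epi_iff_cancel_zero]
      intro G g hg
      rw [← cancel_epi (differenceπ x c.pt), comp_zero]
      refine (isColimitOfPreserves (translation A x) hc).hom_ext fun j => ?_
      have h2 : (difference A x).map (c.ι.app j) ≫ g = 0 := by
        have h3 := colimit.ι_desc ((difference A x).mapCocone c) j
        rw [Functor.mapCocone_ι_app] at h3
        rw [← h3, Category.assoc, hg, comp_zero]
      rw [comp_zero, Functor.mapCocone_ι_app, ← Category.assoc, ← differenceπ_naturality,
        Category.assoc, h2, comp_zero]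
    exact (polFun M A k).prop_of_epi (colimit.desc _ ((difference A x).mapCocone c)) h

instance (k : ℕ) (J : Type w) [SmallCategory J] :
    (polFun M A k).IsClosedUnderColimitsOfShape J where
  colimitsOfShape_le := by
    rintro F ⟨p⟩
    exact polFun_of_isColimit k p.isColimit p.prop_diag_obj

/-- The shape `J` is arbitrary because the case of interest is `J = M`, which need not be filtered.
-/
instance (k : ℕ) (J : Type w) [SmallCategory J] :
    (polFun M A k).isoModSerre.IsStableUnderColimitsOfShape J :=
  isStableUnderColimitsOfShape_isoModSerre _ J

end PolynomialFunctors

/-! ### The functor `η*` preserves and reflects polynomial degree. -/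

section EtaStar

variable {M : Type w} [SmallCategory M] [MonoidalCategory M] [SymmetricCategory M]
  [UnitIsInitial M]
variable {A : Type u} [Category.{v} A] [Abelian A]

theorem kappaι_eq_zero_of_mono (G : M ⥤ A) (x : M) [Mono ((iota A x).app G)] :
    kappaι x G = 0 := by
  rw [← cancel_mono ((iota A x).app G), zero_comp]
  exact kernel.condition _

/-- `i_x` is a monomorphism if there is a morphism from `x` to the unit. -/
theorem mono_iota_of_hom {x : M} (r : x ⟶ 𝟙_ M) (F : M ⥤ A) : Mono ((iota A x).app F) := by
  have : ∀ b, Mono (((iota A x).app F).app b) := fun b => by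
    -- Since the unit is initial, `r` is a retraction of `fromUnit x`; this splits `i_x` at every
    -- object.
    have h : ((λ_ b).inv ≫ fromUnit x ▷ b) ≫ r ▷ b ≫ (λ_ b).hom = 𝟙 b := by
      have h1 : fromUnit x ≫ r = 𝟙 _ := fromUnit_unique _ _
      rw [Category.assoc, ← comp_whiskerRight_assoc, h1]
      simp
    have h2 : F.map ((λ_ b).inv ≫ fromUnit x ▷ b) ≫ F.map (r ▷ b ≫ (λ_ b).hom) = 𝟙 _ := by
      rw [← F.map_comp, h, F.map_id]
    exact (SplitMono.mk _ h2).mono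
  exact NatTrans.mono_of_mono_app _

namespace Tilde

/-- The morphism of `M~` from `x` to the unit. -/
def toUnit (x : Tilde M) : x ⟶ 𝟙_ (Tilde M) := mk x.of (λ_ x.of).inv

end Tilde

instance mono_iota_tilde (x : Tilde M) (G : Tilde M ⥤ A) : Mono ((iota A x).app G) :=
  mono_iota_of_hom x.toUnit G

/-- The functor `η*` commutes with the translation functors. -/
def translationEtaIso (x : M) (G : Tilde M ⥤ A) :
    (etaStar M A).obj ((translation A (Tilde.ob x)).obj G) ≅
      (translation A x).obj ((etaStar M A).obj G) :=
  NatIso.ofComponents (fun b => Iso.refl _) (fun {b c} f => by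
    refine (Category.comp_id _).trans (Eq.trans ?_ (Category.id_comp _).symm)
    exact congrArg (fun g => G.map g) (Tilde.sumHom_id_ofHom (Tilde.ob x) (b := ⟨b⟩) (c := ⟨c⟩) f))

/-- The unit of `M~` is initial, so its map to `x` must be the image under `η` of the one in `M`. -/
theorem map_iota_comp_translationEtaIso (x : M) (G : Tilde M ⥤ A) :
    (etaStar M A).map ((iota A (Tilde.ob x)).app G) ≫ (translationEtaIso x G).hom =
      (iota A x).app ((etaStar M A).obj G) := by
  ext b
  refine (Category.comp_id _).trans (congrArg (fun g => G.map g) ?_)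
  have h : fromUnit (Tilde.ob x) = Tilde.ofHom (a := 𝟙_ (Tilde M)) (fromUnit x) :=
    fromUnit_unique _ _
  change (λ_ (Tilde.ob b)).inv ≫ fromUnit (Tilde.ob x) ▷ Tilde.ob b =
    Tilde.ofHom (a := ⟨b⟩) (b := ⟨x ⊗ b⟩) ((λ_ b).inv ≫ fromUnit x ▷ b)
  rw [h]
  exact (congrArg _ (Tilde.sumHom_ofHom_id (Tilde.ob b) (b := 𝟙_ (Tilde M)) (c := Tilde.ob x)
    (fromUnit x))).trans (Tilde.ofHom_comp (a := ⟨b⟩) (b := ⟨𝟙_ M ⊗ b⟩) (c := ⟨x ⊗ b⟩) _ _)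

/-- The functor `η*` commutes with the difference functors. -/
noncomputable def differenceEtaIso (x : M) (G : Tilde M ⥤ A) :
    (etaStar M A).obj ((difference A (Tilde.ob x)).obj G) ≅
      (difference A x).obj ((etaStar M A).obj G) :=
  PreservesCokernel.iso (etaStar M A) ((iota A (Tilde.ob x)).app G) ≪≫
    cokernel.mapIso _ _ (Iso.refl _) (translationEtaIso x G)
      ((map_iota_comp_translationEtaIso x G).trans (Category.id_comp _).symm)

instance mono_iota_etaStar (x : M) (G : Tilde M ⥤ A) :
    Mono ((iota A x).app ((etaStar M A).obj G)) := by
  rw [← map_iota_comp_translationEtaIso]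
  infer_instance

variable [IsGrothendieckAbelian.{w} A]

theorem isZero_of_stablyZero {F : M ⥤ A} [∀ x : M, Mono ((iota A x).app F)]
    (hF : stablyZero M A F) : IsZero F := by
  rw [IsZero.iff_id_eq_zero]
  exact (stablyZero_iff F).1 hF _ fun x => by rw [kappaι_eq_zero_of_mono, zero_comp]

/-- On both sides the maps `i_x` are monomorphisms, so stably zero means zero; and vanishing is
tested on objects, which `M` and `M~` share. -/
theorem stablyZero_etaStar_iff (G : Tilde M ⥤ A) :
    stablyZero M A ((etaStar M A).obj G) ↔ stablyZero (Tilde M) A G := by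
  constructor
  · intro h
    refine (stablyZero (Tilde M) A).prop_of_isZero ?_
    have := isZero_of_stablyZero h
    rw [Functor.isZero_iff] at this ⊢
    exact fun b => this b.of
  · intro h
    exact (stablyZero M A).prop_of_isZero ((etaStar M A).map_isZero (isZero_of_stablyZero h))

/-- The induction step is the commutation of `η*` with `δ_x`; reflection also uses that every object
of `M~` comes from `M`. -/
theorem polFun_etaStar_iff (k : ℕ) (G : Tilde M ⥤ A) :
    polFun M A k ((etaStar M A).obj G) ↔ polFun (Tilde M) A k G := by
  induction k generalizing G with
  | zero => rw [polFun_zero_iff, polFun_zero_iff, stablyZero_etaStar_iff]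
  | succ k ih =>
    rw [polFun_succ_iff, polFun_succ_iff]
    constructor
    · intro h x
      exact (ih _).1 ((polFun M A k).prop_of_iso (differenceEtaIso x.of G).symm (h x.of))
    · intro h x
      exact (polFun M A k).prop_of_iso (differenceEtaIso x G) ((ih _).2 (h ⟨x⟩))

theorem isoModSerre_etaStar_iff (k : ℕ) {G G' : Tilde M ⥤ A} (f : G ⟶ G') :
    (polFun M A k).isoModSerre ((etaStar M A).map f) ↔ (polFun (Tilde M) A k).isoModSerre f := by
  rw [← isoModSerre_inverseImage]
  have h : polFun (Tilde M) A k = (polFun M A k).inverseImage (etaStar M A) := by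
    ext G
    exact (polFun_etaStar_iff k G).symm
  simp only [h]

end EtaStar

/-! ### Cofinality of the morphisms `t ⊗ b ⟶ b` in `M~`. -/

namespace Tilde

variable {M : Type w} [SmallCategory M] [MonoidalCategory M] [SymmetricCategory M]

/-- The morphism `t ⊗ b ⟶ b` of `M~`. -/
def proj (t b : M) : (eta M).obj (t ⊗ b) ⟶ (eta M).obj b :=
  mk (a := ⟨t ⊗ b⟩) (b := ⟨b⟩) t (β_ t b).hom

theorem eta_map_proj {a b t : M} (g : a ⟶ t ⊗ b) :
    (eta M).map g ≫ proj t b = mk (a := ⟨a⟩) (b := ⟨b⟩) t (g ≫ (β_ t b).hom) :=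
  ofHom_comp_mk (a := ⟨a⟩) (b := ⟨t ⊗ b⟩) (c := ⟨b⟩) _ _

theorem eta_map_whiskerRight_proj {t t' : M} (s : t ⟶ t') (b : M) :
    (eta M).map (s ▷ b) ≫ proj t' b = proj t b := by
  rw [eta_map_proj, BraidedCategory.braiding_naturality_left]
  exact (mk_eq s _ _ rfl).symm

theorem eta_map_whiskerLeft_proj (t : M) {b b' : M} (f : b ⟶ b') :
    (eta M).map (t ◁ f) ≫ proj t b' = proj t b ≫ (eta M).map f := by
  rw [eta_map_proj, BraidedCategory.braiding_naturality_right]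
  exact (mk_comp_ofHom (a := ⟨t ⊗ b⟩) (b := ⟨b⟩) (c := ⟨b'⟩) _ _).symm

/-- The functor `t ↦ (t ⊗ b ⟶ b)`. -/
def projFunctor (b : M) : M ⥤ CostructuredArrow (eta M) ((eta M).obj b) where
  obj t := CostructuredArrow.mk (proj t b)
  map s := CostructuredArrow.homMk (s ▷ b) (eta_map_whiskerRight_proj s b)
  map_id t := by ext; simp
  map_comp s s' := by ext; simp

/-- The object over `projFunctor b` given by a representative of a morphism of `M~`. -/
def representative {a b : M} (ξ : (eta M).obj a ⟶ (eta M).obj b) (t : M) (f : a ⟶ b ⊗ t)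
    (h : mk (a := ⟨a⟩) (b := ⟨b⟩) t f = ξ) :
    StructuredArrow (CostructuredArrow.mk ξ) (projFunctor b) :=
  StructuredArrow.mk (Y := t) (CostructuredArrow.homMk (f ≫ (β_ t b).inv) (by
    refine (eta_map_proj (f ≫ (β_ t b).inv)).trans (Eq.trans (congrArg _ ?_) h)
    exact (Category.assoc _ _ _).trans ((congrArg _ (β_ t b).inv_hom_id).trans (Category.comp_id _))))

/-- A morphism between objects given by representatives of the same morphism. -/
def representativeHom {a b : M} (ξ : (eta M).obj a ⟶ (eta M).obj b) {t t' : M} {f : a ⟶ b ⊗ t}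
    {f' : a ⟶ b ⊗ t'} (h : mk (a := ⟨a⟩) (b := ⟨b⟩) t f = ξ)
    (h' : mk (a := ⟨a⟩) (b := ⟨b⟩) t' f' = ξ) (s : t ⟶ t') (hs : f ≫ b ◁ s = f') :
    representative ξ t f h ⟶ representative ξ t' f' h' :=
  StructuredArrow.homMk s (by
    ext
    change (f ≫ (β_ t b).inv) ≫ s ▷ b = f' ≫ (β_ t' b).inv
    rw [← hs, Category.assoc, Category.assoc, BraidedCategory.braiding_inv_naturality_right])

/-- A generator of the equivalence relation defining the colimit is a morphism `t ⟶ t'` compatible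
with the representatives, hence a morphism of the comma category; a chain of generators gives a
zigzag. -/
theorem zigzag_representative {a b : M} (ξ : (eta M).obj a ⟶ (eta M).obj b)
    (p q : Σ t : M, (a ⟶ b ⊗ t))
    (hpq : Relation.EqvGen (tensorLeft b ⋙ coyoneda.obj (Opposite.op a)).ColimitTypeRel p q)
    (hp : mk (a := ⟨a⟩) (b := ⟨b⟩) p.1 p.2 = ξ) (hq : mk (a := ⟨a⟩) (b := ⟨b⟩) q.1 q.2 = ξ) :
    Zigzag (representative ξ p.1 p.2 hp) (representative ξ q.1 q.2 hq) := by
  induction hpq with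
  | rel p q h =>
    obtain ⟨s, hs⟩ := h
    exact Zigzag.of_hom (representativeHom ξ hp hq s hs.symm)
  | refl => exact Zigzag.refl _
  | symm p q _ ih => exact (ih hq hp).symm
  | trans p q r h _ ih ih' =>
    have hr : mk (a := ⟨a⟩) (b := ⟨b⟩) q.1 q.2 = ξ := (Quot.eqvGen_sound h).symm.trans hp
    exact (ih hp hr).trans (ih' hr hq)

/-- Up to a braiding, the comma category under `ξ` is the category of representatives of `ξ`. It is
nonempty because `ξ` has a representative, and connected because any two represent the same element
of the colimit. -/
instance final_projFunctor (b : M) : (projFunctor b).Final where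
  out := by
    intro d
    obtain ⟨a, ⟨⟨⟩⟩, ξ⟩ := d
    change IsConnected (StructuredArrow (CostructuredArrow.mk ξ) (projFunctor b))
    have : Nonempty (StructuredArrow (CostructuredArrow.mk ξ) (projFunctor b)) := by
      obtain ⟨t, f, h⟩ := mk_surjective ξ
      exact ⟨representative ξ t f h⟩
    refine zigzag_isConnected fun x y => ?_
    -- An arbitrary object is a map `a ⟶ t ⊗ b`; composing with the braiding turns it into a
    -- representative `a ⟶ b ⊗ t`.
    have hr : ∀ x : StructuredArrow (CostructuredArrow.mk ξ) (projFunctor b),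
        ∃ (t : M) (f : a ⟶ b ⊗ t) (h : mk (a := ⟨a⟩) (b := ⟨b⟩) t f = ξ),
          Zigzag x (representative ξ t f h) := by
      intro x
      refine ⟨x.right, x.hom.left ≫ (β_ x.right b).hom,
        (eta_map_proj _).symm.trans (CostructuredArrow.w x.hom),
        Zigzag.of_hom (StructuredArrow.homMk (𝟙 _) ?_)⟩
      have hg : ∀ (t : M) (g : a ⟶ t ⊗ b), g ≫ 𝟙 t ▷ b = (g ≫ (β_ t b).hom) ≫ (β_ t b).inv := by
        simp
      ext
      exact hg _ _
    obtain ⟨t, f, h, hx⟩ := hr x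
    obtain ⟨t', f', h', hy⟩ := hr y
    exact hx.trans ((zigzag_representative ξ ⟨t, f⟩ ⟨t', f'⟩
      (Quot.eqvGen_exact (h.trans h'.symm)) h h').trans hy.symm)

end Tilde

/-! ### The restriction of a Kan extension as a colimit of translates. -/

section Colimit

variable {M : Type w} [SmallCategory M] [MonoidalCategory M] [SymmetricCategory M]
variable {A : Type u} [Category.{v} A]

/-- The functor `t ↦ τ_t(F)`. -/
def translationDiagram (F : M ⥤ A) : M ⥤ M ⥤ A :=
  tensoringLeft M ⋙ (Functor.whiskeringLeft M M A) ⋙ (evaluation (M ⥤ A) (M ⥤ A)).obj F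

/-- The cocone over `t ↦ τ_t(F)` given by a morphism from `F` to the restriction to `M` of a functor
on `M~`. -/
def extensionCocone {F : M ⥤ A} {G : Tilde M ⥤ A} (u : F ⟶ (etaStar M A).obj G) :
    Cocone (translationDiagram F) where
  pt := (etaStar M A).obj G
  ι :=
    { app t :=
        { app b := u.app (t ⊗ b) ≫ G.map (Tilde.proj t b)
          naturality b c f := by
            refine ((u.naturality_assoc (t ◁ f) _).trans ?_).trans (Category.assoc _ _ _).symm
            refine congrArg (fun g => u.app (t ⊗ b) ≫ g) ?_
            exact ((G.map_comp _ _).symm.trans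
              (congrArg G.map (Tilde.eta_map_whiskerLeft_proj t f))).trans (G.map_comp _ _) }
      naturality t t' s := by
        ext b
        refine ((u.naturality_assoc (s ▷ b) _).trans ?_).trans (Category.comp_id _).symm
        refine congrArg (fun g => u.app (t ⊗ b) ≫ g) ?_
        exact (G.map_comp _ _).symm.trans (congrArg G.map (Tilde.eta_map_whiskerRight_proj s b)) }

/-- If the extension is a pointwise left Kan extension, its restriction to `M` is the colimit of
the translates. -/
noncomputable def isColimitExtensionCocone {F : M ⥤ A} {G : Tilde M ⥤ A}
    (u : F ⟶ (etaStar M A).obj G)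
    (h : (Functor.LeftExtension.mk G u).IsPointwiseLeftKanExtension) :
    IsColimit (extensionCocone u) :=
  -- At each `b`, the pointwise Kan extension formula is restricted along the final functor `t ↦ (t
  -- ⊗ b ⟶ b)`.
  evaluationJointlyReflectsColimits _ fun b =>
    ((Functor.Final.isColimitWhiskerEquiv (Tilde.projFunctor b) _).symm
      (h ((Tilde.eta M).obj b))).ofIsoColimit (Cocone.ext (Iso.refl _) fun _ => Category.comp_id _)

/-- The composite of `i_t` and the leg of index `t` of the cocone is the given morphism. -/
theorem iota_comp_extensionCocone [UnitIsInitial M] {F : M ⥤ A} {G : Tilde M ⥤ A}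
    (u : F ⟶ (etaStar M A).obj G) (t : M) :
    (iota A t).app F ≫ (extensionCocone u).ι.app t = u := by
  ext b
  refine (u.naturality_assoc ((λ_ b).inv ≫ fromUnit t ▷ b) _).trans ?_
  refine Eq.trans (congrArg (fun g => u.app b ≫ g) ?_) (Category.comp_id _)
  refine ((G.map_comp _ _).symm.trans (congrArg G.map ?_)).trans (G.map_id _)
  refine (Tilde.eta_map_proj _).trans (Eq.trans ?_ (Tilde.id_eq _).symm)
  -- The transition map along `𝟙_ M ⟶ t` takes the representative of the identity of `b` with index
  -- the unit to one with index `t`.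
  refine (Tilde.mk_eq (fromUnit t) _ _ ?_).symm
  change (ρ_ b).inv ≫ b ◁ fromUnit t = ((λ_ b).inv ≫ fromUnit t ▷ b) ≫ (β_ t b).hom
  rw [Category.assoc, BraidedCategory.braiding_naturality_left]
  simp

end Colimit

/-! ### The unit `F ⟶ η* α F` modulo lower degree, and the effect of `α`. -/

section Unit

variable {M : Type w} [SmallCategory M] [MonoidalCategory M] [SymmetricCategory M]
  [UnitIsInitial M]
variable {A : Type u} [Category.{v} A] [Abelian A] [IsGrothendieckAbelian.{w} A]

/-- `η* α F` is the colimit of the translates of `F`. -/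
noncomputable def isColimitLan (F : M ⥤ A) :
    IsColimit (extensionCocone ((Tilde.eta M).lanUnit.app F)) :=
  isColimitExtensionCocone _
    ((Tilde.eta M).isPointwiseLeftKanExtensionLeftKanExtensionUnit F)

/-- The unit `F ⟶ η* α F` is an isomorphism modulo functors of degree less than that of `F`. -/
theorem isoModSerre_lanUnit {k : ℕ} {F : M ⥤ A} (hF : polFun M A (k + 1) F) :
    (polFun M A k).isoModSerre ((Tilde.eta M).lanUnit.app F) := by
  -- Connectedness of `M` is what makes `F` itself the colimit of the constant diagram on `F`.
  have : HasInitial M :=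
    (UnitIsInitial.nonempty_isInitial (M := M)).some.hasInitial
  have := isConnected_of_hasInitial M
  refine MorphismProperty.IsStableUnderColimitsOfShape.condition (W := (polFun M A k).isoModSerre)
    _ _ _ _ (isColimitConstCocone M F) (isColimitLan F)
    { app t := (iota A t).app F
      naturality t t' s := (Category.id_comp _).trans (iota_comp_map s F).symm }
    (fun t => isoModSerre_iota hF t) _ (fun t => ?_)
  exact (Category.id_comp _).trans (iota_comp_extensionCocone _ t).symm

theorem isoModSerre_map_translation (x : M) {F F' : M ⥤ A} (f : F ⟶ F')
    (hf : (polFun M A 0).isoModSerre f) :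
    (polFun M A 0).isoModSerre ((translation A x).map f) := by
  rw [← isoModSerre_inverseImage]
  have h : polFun M A 0 ≤ (polFun M A 0).inverseImage (translation A x) := fun G hG =>
    (polFun_zero_iff _).2 (stablyZero_translation x ((polFun_zero_iff G).1 hG))
  exact ⟨h _ hf.1, h _ hf.2⟩

/-- The functor `α` preserves isomorphisms modulo stably zero functors. -/
theorem isoModSerre_map_alpha {F F' : M ⥤ A} (f : F ⟶ F')
    (hf : (polFun M A 0).isoModSerre f) :
    (polFun (Tilde M) A 0).isoModSerre ((alpha M A).map f) := by
  -- After `η*`, the map is a colimit of the `τ_t(f)`, and each `τ_t` is exact and preserves stably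
  -- zero functors.
  rw [← isoModSerre_etaStar_iff]
  refine MorphismProperty.IsStableUnderColimitsOfShape.condition (W := (polFun M A 0).isoModSerre)
    _ _ _ _ (isColimitLan F) (isColimitLan F')
    (Functor.whiskerLeft (tensoringLeft M ⋙ (Functor.whiskeringLeft M M A))
      ((evaluation (M ⥤ A) (M ⥤ A)).map f)) (fun t => ?_) _ (fun t => ?_)
  · exact isoModSerre_map_translation t f hf
  · ext b
    refine (Category.assoc _ _ _).trans (Eq.trans ?_ (Category.assoc _ _ _))
    have h := NatTrans.congr_app ((Tilde.eta M).lanUnit.naturality f) (t ⊗ b)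
    refine Eq.trans ?_ (congrArg (fun g => g ≫ ((alpha M A).obj F').map (Tilde.proj t b)) h).symm
    refine Eq.trans ?_ (Category.assoc _ _ _).symm
    exact congrArg (fun g => ((Tilde.eta M).lanUnit.app F).app (t ⊗ b) ≫ g)
      (((alpha M A).map f).naturality (Tilde.proj t b))

end Unit

section

variable {C : Type*} [Category* C] [Abelian C] (P : ObjectProperty C) [P.IsSerreClass]

/-- The target is an extension of the cokernel of `f` by a quotient of the source. -/
theorem prop_of_isoModSerre {X Y : C} (f : X ⟶ Y) (hf : P.isoModSerre f) (hX : P X) : P Y := by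
  have h : (ShortComplex.mk (Abelian.image.ι f) (cokernel.π f) (by simp)).ShortExact :=
    { exact := ShortComplex.exact_of_f_is_kernel _ (kernelIsKernel (cokernel.π f)) }
  exact P.prop_X₂_of_shortExact h (P.prop_of_epi (Abelian.factorThruImage f) hX) hf.2

theorem isoModSerre_mono {Q : ObjectProperty C} [Q.IsSerreClass] (h : P ≤ Q) :
    P.isoModSerre ≤ Q.isoModSerre :=
  fun _ _ _ hf => ⟨h _ hf.1, h _ hf.2⟩

end

section Adjunction

variable {M : Type w} [SmallCategory M] [MonoidalCategory M] [SymmetricCategory M]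
  [UnitIsInitial M]
variable {A : Type u} [Category.{v} A] [Abelian A] [IsGrothendieckAbelian.{w} A]

theorem isoModSerre_lanAdjunction_unit {k : ℕ} {F : M ⥤ A} (hF : polFun M A (k + 1) F) :
    (polFun M A k).isoModSerre (((Tilde.eta M).lanAdjunction A).unit.app F) := by
  rw [Functor.lanAdjunction_unit]
  exact isoModSerre_lanUnit hF

/-- The functor `α` preserves polynomial functors. -/
theorem polFun_alpha {k : ℕ} {F : M ⥤ A} (hF : polFun M A (k + 1) F) :
    polFun (Tilde M) A (k + 1) ((alpha M A).obj F) := by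
  rw [← polFun_etaStar_iff]
  -- The unit is an isomorphism even modulo lower degree, so `η* α F` inherits the degree bound of
  -- `F`.
  exact prop_of_isoModSerre _ _
    (isoModSerre_mono _ (polFun_le_succ k) _ (isoModSerre_lanAdjunction_unit hF)) hF

end Adjunction

/-! ### Descent of functors through the successive quotients. -/

section Induces

variable {M : Type w} [SmallCategory M] [MonoidalCategory M] [SymmetricCategory M]
  [UnitIsInitial M] {N : Type w} [SmallCategory N] [MonoidalCategory N] [SymmetricCategory N]
  [UnitIsInitial N] {A : Type u} [Category.{v} A] [Abelian A] [IsGrothendieckAbelian.{w} A]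

/-- The inducing square is pasted from three: passage to the stable categories, restriction to
polynomial objects, and passage to the quotients. -/
theorem induces_of_iso {Φ : (M ⥤ A) ⥤ (N ⥤ A)} {Φ₁ : St M A ⥤ St N A}
    (e₁ : stQ M A ⋙ Φ₁ ≅ Φ ⋙ stQ N A) {n : ℤ}
    {Φ₂ : (Pol M A n).FullSubcategory ⥤ (Pol N A n).FullSubcategory}
    (e₂ : (Pol M A n).ι ⋙ Φ₁ ≅ Φ₂ ⋙ (Pol N A n).ι) {E : PolQuot M A n ⥤ PolQuot N A n}
    (e₃ : polQuotQ M A n ⋙ E ≅ Φ₂ ⋙ polQuotQ N A n) : Induces Φ n E := by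
  let L := (Pol M A n).lift ((IsPol M A n).ι ⋙ stQ M A) (fun F => F.property)
  have h : ∀ F : (IsPol M A n).FullSubcategory, IsPol N A n (Φ.obj F.obj) := fun F =>
    (Pol N A n).prop_of_iso ((e₂.app (L.obj F)).symm ≪≫ e₁.app F.obj) (Φ₂.obj (L.obj F)).property
  let L' := (Pol N A n).lift ((IsPol N A n).ι ⋙ stQ N A) (fun F => F.property)
  have e₄ : (IsPol N A n).lift ((IsPol M A n).ι ⋙ Φ) h ⋙ L' ≅ L ⋙ Φ₂ :=
    Functor.fullyFaithfulCancelRight (Pol N A n).ι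
      (Functor.isoWhiskerLeft (IsPol M A n).ι e₁.symm ≪≫ Functor.isoWhiskerLeft L e₂)
  exact ⟨h, ⟨Functor.isoWhiskerRight e₄ (polQuotQ N A n) ≪≫
    Functor.isoWhiskerLeft L e₃.symm⟩⟩

end Induces

/-- Used to check units and counits only on objects in the image of a localization functor, which is
essentially surjective. -/
theorem arrow_iff_of_natTrans {C D : Type*} [Category* C] [Category* D] (W : MorphismProperty D)
    [W.RespectsIso] {F G : C ⥤ D} (τ : F ⟶ G) {X Y : C} (e : X ≅ Y) :
    W (τ.app X) ↔ W (τ.app Y) :=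
  W.arrow_mk_iso_iff (Arrow.isoMk (F.mapIso e) (G.mapIso e) (τ.naturality e.hom))

/-! ### The adjunction between the stable categories. -/

section StAdjunction

variable (M : Type w) [SmallCategory M] [MonoidalCategory M] [SymmetricCategory M]
  [UnitIsInitial M]
variable (A : Type u) [Category.{v} A] [Abelian A] [IsGrothendieckAbelian.{w} A]

theorem polFun_zero : polFun M A 0 = stablyZero M A := by
  ext F
  exact polFun_zero_iff F

theorem isoModSerre_polFun_zero_iff {F G : M ⥤ A} (f : F ⟶ G) :
    (polFun M A 0).isoModSerre f ↔ (stablyZero M A).isoModSerre f := by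
  simp only [polFun_zero]

/-- The functor `α`, as a morphism between the localizations defining the stable categories. -/
noncomputable def alphaLocalizer :
    LocalizerMorphism (stablyZero M A).isoModSerre (stablyZero (Tilde M) A).isoModSerre where
  functor := alpha M A
  map _ _ f hf := (isoModSerre_polFun_zero_iff _ _ _).1
    (isoModSerre_map_alpha f ((isoModSerre_polFun_zero_iff _ _ _).2 hf))

/-- The functor `η*`, as a morphism between the localizations defining the stable categories. -/
def etaLocalizer :
    LocalizerMorphism (stablyZero (Tilde M) A).isoModSerre (stablyZero M A).isoModSerre where
  functor := etaStar M A
  map _ _ f hf := (isoModSerre_polFun_zero_iff _ _ _).1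
    ((isoModSerre_etaStar_iff 0 f).2 ((isoModSerre_polFun_zero_iff _ _ _).2 hf))

/-- The functor `St(M, A) ⥤ St(M~, A)` induced by `α`. -/
noncomputable def stAlpha : St M A ⥤ St (Tilde M) A :=
  (alphaLocalizer M A).localizedFunctor (stQ M A) (stQ (Tilde M) A)

/-- The functor `St(M~, A) ⥤ St(M, A)` induced by `η*`. -/
noncomputable def stEta : St (Tilde M) A ⥤ St M A :=
  (etaLocalizer M A).localizedFunctor (stQ (Tilde M) A) (stQ M A)

noncomputable instance : CatCommSq (alpha M A) (stQ M A) (stQ (Tilde M) A) (stAlpha M A) :=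
  (alphaLocalizer M A).catCommSq (stQ M A) (stQ (Tilde M) A)

noncomputable instance : CatCommSq (etaStar M A) (stQ (Tilde M) A) (stQ M A) (stEta M A) :=
  (etaLocalizer M A).catCommSq (stQ (Tilde M) A) (stQ M A)

/-- The functor `stAlpha` is induced by `α`. -/
noncomputable def stAlphaIso : stQ M A ⋙ stAlpha M A ≅ alpha M A ⋙ stQ (Tilde M) A :=
  (CatCommSq.iso (alpha M A) (stQ M A) (stQ (Tilde M) A) (stAlpha M A)).symm

/-- The functor `stEta` is induced by `η*`. -/
noncomputable def stEtaIso : stQ (Tilde M) A ⋙ stEta M A ≅ etaStar M A ⋙ stQ M A :=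
  (CatCommSq.iso (etaStar M A) (stQ (Tilde M) A) (stQ M A) (stEta M A)).symm

/-- The adjunction between the functors induced by `α` and `η*`. -/
noncomputable def stAdjunction : stAlpha M A ⊣ stEta M A :=
  ((Tilde.eta M).lanAdjunction A).localization (stQ M A) (stablyZero M A).isoModSerre
    (stQ (Tilde M) A) (stablyZero (Tilde M) A).isoModSerre (stAlpha M A) (stEta M A)

instance : PreservesFiniteLimits (stEta M A) := by
  have : PreservesFiniteLimits (stQ (Tilde M) A ⋙ stEta M A) :=
    preservesFiniteLimits_of_natIso (stEtaIso M A).symm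
  exact (ObjectProperty.SerreClassLocalization.preservesFiniteLimits_comp_iff _
      (stablyZero (Tilde M) A) _).1 this

instance : PreservesFiniteColimits (stEta M A) := by
  have : PreservesFiniteColimits (stQ (Tilde M) A ⋙ stEta M A) :=
    preservesFiniteColimits_of_natIso (stEtaIso M A).symm
  exact (ObjectProperty.SerreClassLocalization.preservesFiniteColimits_comp_iff _
      (stablyZero (Tilde M) A) _).1 this

variable {M A}

theorem exists_iso_stQ_obj (X : St M A) : ∃ F : M ⥤ A, Nonempty ((stQ M A).obj F ≅ X) := by
  have := Localization.essSurj (stQ M A) (stablyZero M A).isoModSerre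
  exact ⟨_, ⟨(stQ M A).objObjPreimageIso X⟩⟩

theorem polAux_stEta_iff (k : ℕ) (Y : St (Tilde M) A) :
    polAux M A k ((stEta M A).obj Y) ↔ polAux (Tilde M) A k Y := by
  obtain ⟨G, ⟨e⟩⟩ := exists_iso_stQ_obj Y
  rw [← (polAux (Tilde M) A k).prop_iff_of_iso e,
    ← (polAux M A k).prop_iff_of_iso ((stEta M A).mapIso e)]
  exact ((polAux M A k).prop_iff_of_iso ((stEtaIso M A).app G)).trans (polFun_etaStar_iff k G)

theorem isoModSerre_stEta_iff (k : ℕ) {Y Y' : St (Tilde M) A} (f : Y ⟶ Y') :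
    (polAux M A k).isoModSerre ((stEta M A).map f) ↔ (polAux (Tilde M) A k).isoModSerre f := by
  rw [← isoModSerre_inverseImage]
  have h : polAux (Tilde M) A k = (polAux M A k).inverseImage (stEta M A) := by
    ext Y
    exact (polAux_stEta_iff k Y).symm
  simp only [h]

theorem polAux_stAlpha {k : ℕ} {X : St M A} (hX : polAux M A (k + 1) X) :
    polAux (Tilde M) A (k + 1) ((stAlpha M A).obj X) := by
  obtain ⟨F, ⟨e⟩⟩ := exists_iso_stQ_obj X
  have hF : polFun M A (k + 1) F := (polAux M A (k + 1)).prop_of_iso e.symm hX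
  exact (polAux (Tilde M) A (k + 1)).prop_of_iso
    (((stAlphaIso M A).app F).symm ≪≫ (stAlpha M A).mapIso e) (polFun_alpha hF)

theorem isoModSerre_stAdjunction_unit {k : ℕ} {X : St M A} (hX : polAux M A (k + 1) X) :
    (polAux M A k).isoModSerre ((stAdjunction M A).unit.app X) := by
  obtain ⟨F, ⟨e⟩⟩ := exists_iso_stQ_obj X
  have hF : polFun M A (k + 1) F := (polAux M A (k + 1)).prop_of_iso e.symm hX
  refine (arrow_iff_of_natTrans _ (stAdjunction M A).unit e).1 ?_
  -- On the image of `F`, the localized unit is the image of the unit `F ⟶ η* α F` followed by an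
  -- isomorphism.
  rw [stAdjunction, Adjunction.localization_unit_app]
  refine (MorphismProperty.cancel_right_of_respectsIso (polAux M A k).isoModSerre _ _).2 ?_
  rw [← isoModSerre_inverseImage]
  exact isoModSerre_lanAdjunction_unit hF

/-- Reflection by `stEta` reduces this to the image of the counit, which is a one-sided inverse of a
unit component by the triangle identity; two-out-of-three concludes. -/
theorem isoModSerre_stAdjunction_counit {k : ℕ} {Y : St (Tilde M) A}
    (hY : polAux (Tilde M) A (k + 1) Y) :
    (polAux (Tilde M) A k).isoModSerre ((stAdjunction M A).counit.app Y) := by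
  rw [← isoModSerre_stEta_iff]
  refine MorphismProperty.of_precomp _ _ _
    (isoModSerre_stAdjunction_unit ((polAux_stEta_iff _ Y).2 hY)) ?_
  rw [(stAdjunction M A).right_triangle_components]
  exact MorphismProperty.id_mem _ _

/-- Exactness of `stAlpha` is avoided: in the naturality square of the unit three sides are
isomorphisms modulo lower degree, hence so is `stEta` of the map in question, and `stEta` reflects
this. The degree bounds make the two unit components admissible. -/
theorem isoModSerre_stAlpha_map {k : ℕ} {X X' : St M A} (hX : polAux M A (k + 1) X)
    (hX' : polAux M A (k + 1) X') {f : X ⟶ X'} (hf : (polAux M A k).isoModSerre f) :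
    (polAux (Tilde M) A k).isoModSerre ((stAlpha M A).map f) := by
  rw [← isoModSerre_stEta_iff]
  refine MorphismProperty.of_precomp _ _ _ (isoModSerre_stAdjunction_unit hX) ?_
  have h := (stAdjunction M A).unit.naturality f
  exact h ▸ MorphismProperty.comp_mem _ _ _ hf (isoModSerre_stAdjunction_unit hX')

end StAdjunction

/-! ### The adjunction on the quotients and its invertibility. -/

section PolAdjunction

variable (M : Type w) [SmallCategory M] [MonoidalCategory M] [SymmetricCategory M]
  [UnitIsInitial M]
variable (A : Type u) [Category.{v} A] [Abelian A] [IsGrothendieckAbelian.{w} A] (n : ℕ)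

/-- The index of `polAux` is one more than the degree, so `n` stands for degree at most `n - 1`, and
`Pol M A n` unfolds to `polAux M A (n + 1)`. -/
theorem pol_natCast_sub_one : Pol M A ((n : ℤ) - 1) = polAux M A n := by
  rw [Pol, sub_add_cancel, Int.toNat_natCast]

/-- The isomorphisms of `Pol_n(M, A)` modulo `Pol_{n-1}(M, A)`. -/
abbrev polIso : MorphismProperty (Pol M A n).FullSubcategory :=
  ((Pol M A ((n : ℤ) - 1)).inverseImage (Pol M A n).ι).isoModSerre

variable {M A n} in
theorem polIso_iff {X Y : (Pol M A n).FullSubcategory} (f : X ⟶ Y) :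
    polIso M A n f ↔ (polAux M A n).isoModSerre ((Pol M A n).ι.map f) := by
  rw [polIso, isoModSerre_inverseImage]
  simp only [pol_natCast_sub_one]

/-- The functor `Pol_n(M, A) ⥤ Pol_n(M~, A)` induced by `α`. -/
noncomputable def polAlpha : (Pol M A n).FullSubcategory ⥤ (Pol (Tilde M) A n).FullSubcategory :=
  (Pol (Tilde M) A n).lift ((Pol M A n).ι ⋙ stAlpha M A) fun X => polAux_stAlpha X.property

/-- The functor `Pol_n(M~, A) ⥤ Pol_n(M, A)` induced by `η*`. -/
noncomputable def polEta : (Pol (Tilde M) A n).FullSubcategory ⥤ (Pol M A n).FullSubcategory :=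
  (Pol M A n).lift ((Pol (Tilde M) A n).ι ⋙ stEta M A) fun X =>
    (polAux_stEta_iff (n + 1) X.obj).2 X.property

/-- The functor `polAlpha` is a restriction of `stAlpha`. -/
noncomputable def polAlphaIso :
    (Pol M A n).ι ⋙ stAlpha M A ≅ polAlpha M A n ⋙ (Pol (Tilde M) A n).ι := Iso.refl _

/-- The functor `polEta` is a restriction of `stEta`. -/
noncomputable def polEtaIso :
    (Pol (Tilde M) A n).ι ⋙ stEta M A ≅ polEta M A n ⋙ (Pol M A n).ι := Iso.refl _

/-- The restriction to polynomial objects of the adjunction between the functors induced by `α`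
and `η*`. -/
noncomputable def polAdjunction : polAlpha M A n ⊣ polEta M A n :=
  (stAdjunction M A).restrictFullyFaithful (Pol M A n).fullyFaithfulι
    (Pol (Tilde M) A n).fullyFaithfulι (polAlphaIso M A n) (polEtaIso M A n)

/-- The functor `polAlpha`, as a morphism between the localizations defining the quotients. -/
noncomputable def polAlphaLocalizer :
    LocalizerMorphism (polIso M A n) (polIso (Tilde M) A n) where
  functor := polAlpha M A n
  map X Y f hf := (polIso_iff _).2
    (isoModSerre_stAlpha_map X.property Y.property ((polIso_iff f).1 hf))

/-- The functor `polEta`, as a morphism between the localizations defining the quotients. -/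
noncomputable def polEtaLocalizer :
    LocalizerMorphism (polIso (Tilde M) A n) (polIso M A n) where
  functor := polEta M A n
  map _ _ f hf := (polIso_iff _).2
    ((isoModSerre_stEta_iff n _).2 ((polIso_iff f).1 hf))

/-- The functor between the quotients `Pol_n / Pol_{n-1}` induced by `α`. -/
noncomputable def polQuotAlpha : PolQuot M A n ⥤ PolQuot (Tilde M) A n :=
  (polAlphaLocalizer M A n).localizedFunctor (polQuotQ M A n) (polQuotQ (Tilde M) A n)

/-- The functor between the quotients `Pol_n / Pol_{n-1}` induced by `η*`. -/
noncomputable def polQuotEta : PolQuot (Tilde M) A n ⥤ PolQuot M A n :=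
  (polEtaLocalizer M A n).localizedFunctor (polQuotQ (Tilde M) A n) (polQuotQ M A n)

noncomputable instance : CatCommSq (polAlpha M A n) (polQuotQ M A n) (polQuotQ (Tilde M) A n)
    (polQuotAlpha M A n) :=
  (polAlphaLocalizer M A n).catCommSq (polQuotQ M A n) (polQuotQ (Tilde M) A n)

noncomputable instance : CatCommSq (polEta M A n) (polQuotQ (Tilde M) A n) (polQuotQ M A n)
    (polQuotEta M A n) :=
  (polEtaLocalizer M A n).catCommSq (polQuotQ (Tilde M) A n) (polQuotQ M A n)

/-- The adjunction between the functors induced by `α` and `η*` on the quotients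
`Pol_n / Pol_{n-1}`. -/
noncomputable def polQuotAdjunction : polQuotAlpha M A n ⊣ polQuotEta M A n :=
  (polAdjunction M A n).localization (polQuotQ M A n) (polIso M A n)
    (polQuotQ (Tilde M) A n) (polIso (Tilde M) A n) (polQuotAlpha M A n) (polQuotEta M A n)

theorem polIso_unit (X : (Pol M A n).FullSubcategory) :
    polIso M A n ((polAdjunction M A n).unit.app X) := by
  rw [polIso_iff, polAdjunction, Adjunction.map_restrictFullyFaithful_unit_app]
  exact (MorphismProperty.cancel_right_of_respectsIso (polAux M A n).isoModSerre _ _).2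
    (isoModSerre_stAdjunction_unit X.property)

theorem polIso_counit (Y : (Pol (Tilde M) A n).FullSubcategory) :
    polIso (Tilde M) A n ((polAdjunction M A n).counit.app Y) := by
  rw [polIso_iff, polAdjunction, Adjunction.map_restrictFullyFaithful_counit_app]
  refine (MorphismProperty.cancel_left_of_respectsIso (polAux (Tilde M) A n).isoModSerre _ _).2 ?_
  exact (MorphismProperty.cancel_left_of_respectsIso (polAux (Tilde M) A n).isoModSerre _ _).2
    (isoModSerre_stAdjunction_counit Y.property)

instance (X : PolQuot M A n) : IsIso ((polQuotAdjunction M A n).unit.app X) := by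
  have := Localization.essSurj (polQuotQ M A n) (polIso M A n)
  refine (arrow_iff_of_natTrans (MorphismProperty.isomorphisms _) (polQuotAdjunction M A n).unit
    ((polQuotQ M A n).objObjPreimageIso X)).1 ?_
  -- On an object coming from `Pol_n`, the localized unit is, up to an isomorphism, the image of a
  -- morphism that the quotient functor inverts.
  have := Localization.inverts (polQuotQ M A n) (polIso M A n) _
    (polIso_unit M A n ((polQuotQ M A n).objPreimage X))
  rw [polQuotAdjunction, Adjunction.localization_unit_app, MorphismProperty.isomorphisms.iff]
  infer_instance

instance (Y : PolQuot (Tilde M) A n) : IsIso ((polQuotAdjunction M A n).counit.app Y) := by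
  have := Localization.essSurj (polQuotQ (Tilde M) A n) (polIso (Tilde M) A n)
  refine (arrow_iff_of_natTrans (MorphismProperty.isomorphisms _) (polQuotAdjunction M A n).counit
    ((polQuotQ (Tilde M) A n).objObjPreimageIso Y)).1 ?_
  have := Localization.inverts (polQuotQ (Tilde M) A n) (polIso (Tilde M) A n) _
    (polIso_counit M A n ((polQuotQ (Tilde M) A n).objPreimage Y))
  rw [polQuotAdjunction, Adjunction.localization_counit_app, MorphismProperty.isomorphisms.iff]
  infer_instance

end PolAdjunction

theorem mainTheorem2 {M : Type w} [SmallCategory M] [MonoidalCategory M] [SymmetricCategory M]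
    [UnitIsInitial M] {A : Type u} [Category.{v} A] [Abelian A] [IsGrothendieckAbelian.{w} A]
    (n : ℕ) :
    ∃ e : PolQuot (Tilde M) A n ≌ PolQuot M A n,
      Induces (etaStar M A) n e.functor ∧ Induces (alpha M A) n e.inverse :=
  -- The adjunction has `α` as left adjoint, so its equivalence starts from the quotient for `M`; it
  -- is reversed to make `η*` the forward functor.
  ⟨(polQuotAdjunction M A n).toEquivalence.symm,
    induces_of_iso (stEtaIso M A) (polEtaIso M A n)
      (CatCommSq.iso (polEta M A n) (polQuotQ (Tilde M) A n) (polQuotQ M A n)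
        (polQuotEta M A n)).symm,
    induces_of_iso (stAlphaIso M A) (polAlphaIso M A n)
      (CatCommSq.iso (polAlpha M A n) (polQuotQ M A n) (polQuotQ (Tilde M) A n)
        (polQuotAlpha M A n)).symm⟩
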